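/- Let $(L,d,[\ ,\ ])$ be a ($\mathbb Z$-graded) differential graded Lie algebra over a field $\mathbb K$ of characteristic $0$. Let $L[1]$ be the shifted graded vector space, $L[1]^i=L^{i+1}$, with differential $q_1=-d$, and let $SL[1]=\bigoplus_{n\ge 0}L[1]^{\odot n}$ be its graded symmetric coalgebra, with coproduct $\Delta$ determined by $$\Delta(v_1\odot\cdots\odot v_n)=\sum_{k=0}^n\sum_{\sigma\in S(k,n-k)}\epsilon(\sigma)\,(v_{\sigma(1)}\odot\cdots\odot v_{\sigma(k)})\otimes(v_{\sigma(k+1)}\odot\cdots\odot v_{\sigma(n)}),$$ where $S(k,n-k)$ is the set of unshuffles of type $(k,n-k)$ and $\epsilon(\sigma)$ is the Koszul sign. Let $p\colon SL[1]\to L[1]^{\odot 1}=L[1]$ be the projection. Let $Q$ be the codifferential of $SL[1]$, $$Q(v_1\odot\cdots\odot v_n)=\sum_{k=1}^2\ \sum_{\sigma\in S(k,n-k)}\epsilon(\sigma)\,q_k(v_{\sigma(1)}\odot\cdots\odot v_{\sigma(k)})\odot v_{\sigma(k+1)}\odot\cdots\odot v_{\sigma(n)},$$ where $q_1(x)=-d(x)$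 and $q_2(x\odot y)=-(-1)^i[x,y]$ for $x\in L[1]^i$, $y\in L[1]$. Let $\operatorname{Coder}^*(SL[1])=\bigoplus_n\operatorname{Coder}^n(SL[1])$, where $\operatorname{Coder}^n(SL[1])$ is the space of linear maps $\alpha\colon SL[1]\to SL[1]$ of degree $n$ with $\Delta\alpha=(\alpha\otimes\mathrm{id}+\mathrm{id}\otimes\alpha)\Delta$ (with Koszul signs), equipped with the differential $[Q,\alpha]=Q\alpha-(-1)^{n}\alpha Q$ for $\alpha$ of degree $n$. Suppose that $L$ has the splitting property: the morphism of DG-vector spaces $$b\colon \operatorname{Coder}^*(SL[1])\to L[1],\qquad b(\alpha)=p\,\alpha(1),$$ is surjective in cohomology. Then $L$ is homotopy abelian, i.e. $L$ is related to a DG-Lie algebra with trivial bracket by the equivalence relation generated by quasi-isomorphisms of DG-Lie algebras (morphisms of DG-Lie algebras inducing an isomorphism in cohomology). -/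

import Mathlib

universe u

/-! ## Differential graded Lie algebras -/

/-- A differential graded Lie algebra `(L, d, [ , ])` over `K`, with underlying graded vector
space `L = ⨁ᵢ Lⁱ` (`i : ℤ`) given by an internal direct sum decomposition `gr i = Lⁱ`. -/
structure DGLieAlgebra (K : Type u) [Field K] : Type (u + 1) where
  carrier : Type u
  [addCommGroup : AddCommGroup carrier]
  [module : Module K carrier]
  /-- the homogeneous component of degree `i` -/
  gr : ℤ → Submodule K carrier
  isInternal : DirectSum.IsInternal gr
  /-- the differential -/
  d : carrier →ₗ[K] carrier
  d_mem : ∀ {i : ℤ} {x : carrier}, x ∈ gr i → d x ∈ gr (i + 1)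
  d_d : ∀ x : carrier, d (d x) = 0
  /-- the bracket -/
  bracket : carrier →ₗ[K] carrier →ₗ[K] carrier
  bracket_mem : ∀ {i j : ℤ} {x y : carrier}, x ∈ gr i → y ∈ gr j → bracket x y ∈ gr (i + j)
  skew : ∀ {i j : ℤ} {x y : carrier}, x ∈ gr i → y ∈ gr j →
    bracket x y = -((-1 : K) ^ (i * j) • bracket y x)
  jacobi : ∀ {i j : ℤ} {x y : carrier} (z : carrier), x ∈ gr i → y ∈ gr j →
    bracket x (bracket y z) =
      bracket (bracket x y) z + (-1 : K) ^ (i * j) • bracket y (bracket x z)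
  leibniz : ∀ {i : ℤ} {x : carrier} (y : carrier), x ∈ gr i →
    d (bracket x y) = bracket (d x) y + (-1 : K) ^ i • bracket x (d y)

namespace DGLieAlgebra

variable {K : Type u} [Field K]

instance (L : DGLieAlgebra K) : AddCommGroup L.carrier := L.addCommGroup

instance (L : DGLieAlgebra K) : Module K L.carrier := L.module

/-- `Zⁿ(L)`: the degree `n` cocycles. -/
def cocycles (L : DGLieAlgebra K) (n : ℤ) : Submodule K L.carrier :=
  L.gr n ⊓ LinearMap.ker L.d

/-- `Bⁿ(L) = d(Lⁿ⁻¹)`: the degree `n` coboundaries. -/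
def coboundaries (L : DGLieAlgebra K) (n : ℤ) : Submodule K L.carrier :=
  (L.gr (n - 1)).map L.d

/-- `Hⁿ(L) = Zⁿ(L) / Bⁿ(L)`. -/
abbrev Cohomology (L : DGLieAlgebra K) (n : ℤ) : Type u :=
  L.cocycles n ⧸ (L.coboundaries n).submoduleOf (L.cocycles n)

/-- A morphism of DG-Lie algebras: a linear map preserving degrees and commuting with
differentials and brackets. -/
structure Hom (L M : DGLieAlgebra K) where
  toLinearMap : L.carrier →ₗ[K] M.carrier
  map_gr : ∀ {i : ℤ} {x : L.carrier}, x ∈ L.gr i → toLinearMap x ∈ M.gr i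
  map_d : ∀ x : L.carrier, toLinearMap (L.d x) = M.d (toLinearMap x)
  map_bracket : ∀ x y : L.carrier,
    toLinearMap (L.bracket x y) = M.bracket (toLinearMap x) (toLinearMap y)

namespace Hom

variable {L M : DGLieAlgebra K}

theorem map_cocycles (f : Hom L M) (n : ℤ) :
    ∀ x ∈ L.cocycles n, f.toLinearMap x ∈ M.cocycles n := by
  rintro x ⟨hx, hd⟩
  refine ⟨f.map_gr hx, ?_⟩
  change L.d x = 0 at hd
  change M.d _ = 0
  rw [← f.map_d, hd, map_zero]

/-- The map induced on cocycles. -/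
def cocyclesMap (f : Hom L M) (n : ℤ) : L.cocycles n →ₗ[K] M.cocycles n :=
  f.toLinearMap.restrict (f.map_cocycles n)

theorem coboundaries_le_comap (f : Hom L M) (n : ℤ) :
    (L.coboundaries n).submoduleOf (L.cocycles n) ≤
      ((M.coboundaries n).submoduleOf (M.cocycles n)).comap (f.cocyclesMap n) := by
  rintro ⟨x, hx⟩ ⟨y, hy, hxy⟩
  refine ⟨f.toLinearMap y, f.map_gr hy, ?_⟩
  rw [← f.map_d, hxy]
  rfl

/-- The map `Hⁿ(f) : Hⁿ(L) → Hⁿ(M)` induced by a morphism `f : L → M`. -/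
def cohomologyMap (f : Hom L M) (n : ℤ) : L.Cohomology n →ₗ[K] M.Cohomology n :=
  Submodule.mapQ _ _ (f.cocyclesMap n) (f.coboundaries_le_comap n)

/-- A quasi-isomorphism: a morphism inducing an isomorphism in cohomology. -/
def IsQuasiIso (f : Hom L M) : Prop :=
  ∀ n : ℤ, Function.Bijective (f.cohomologyMap n)

end Hom

/-- `L` and `M` are quasi-isomorphic: they are related by the equivalence relation generated by
quasi-isomorphisms. -/
def QuasiIsomorphic (L M : DGLieAlgebra K) : Prop :=
  Relation.EqvGen (fun A B : DGLieAlgebra K => ∃ f : Hom A B, f.IsQuasiIso) L M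

/-- A DG-Lie algebra is abelian if its bracket is trivial. -/
def IsAbelian (L : DGLieAlgebra K) : Prop :=
  ∀ x y : L.carrier, L.bracket x y = 0

/-- A DG-Lie algebra is homotopy abelian if it is quasi-isomorphic to an abelian one. -/
def IsHomotopyAbelian (L : DGLieAlgebra K) : Prop :=
  ∃ A : DGLieAlgebra K, A.IsAbelian ∧ L.QuasiIsomorphic A

end DGLieAlgebra

/-! ## The symmetric coalgebra of a graded vector space -/

namespace GradedSym

open scoped TensorProduct

variable {K : Type u} [Field K] {V : Type u} [AddCommGroup V] [Module K V]

section Algebra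

/-- The relations of graded commutativity `x y = (-1)^{ij} y x`, for `x ∈ Vⁱ`, `y ∈ Vʲ`. -/
inductive Rel (𝒱 : ℤ → Submodule K V) : TensorAlgebra K V → TensorAlgebra K V → Prop
  | comm {i j : ℤ} {x y : V} (hx : x ∈ 𝒱 i) (hy : y ∈ 𝒱 j) :
      Rel 𝒱 (TensorAlgebra.ι K x * TensorAlgebra.ι K y)
        ((-1 : K) ^ (i * j) • (TensorAlgebra.ι K y * TensorAlgebra.ι K x))

/-- The graded symmetric algebra `S V = ⨁ₙ V^{⊙ n}`: the tensor algebra modulo graded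
commutativity. Its product is `⊙`. -/
def Sym (𝒱 : ℤ → Submodule K V) : Type u := RingQuot (Rel 𝒱)

instance (𝒱 : ℤ → Submodule K V) : Ring (Sym 𝒱) := inferInstanceAs (Ring (RingQuot (Rel 𝒱)))

instance (𝒱 : ℤ → Submodule K V) : Algebra K (Sym 𝒱) :=
  inferInstanceAs (Algebra K (RingQuot (Rel 𝒱)))

variable (𝒱 : ℤ → Submodule K V)

/-- The quotient morphism from the tensor algebra. -/
def mkAlgHom : TensorAlgebra K V →ₐ[K] Sym 𝒱 := RingQuot.mkAlgHom K (Rel 𝒱)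

/-- The inclusion `V = V^{⊙ 1} → S V`. -/
def ι : V →ₗ[K] Sym 𝒱 :=
  (mkAlgHom 𝒱).toLinearMap ∘ₗ TensorAlgebra.ι K

variable {𝒱}

theorem ι_mul_ι {i j : ℤ} {x y : V} (hx : x ∈ 𝒱 i) (hy : y ∈ 𝒱 j) :
    ι 𝒱 x * ι 𝒱 y = (-1 : K) ^ (i * j) • (ι 𝒱 y * ι 𝒱 x) := by
  have h := RingQuot.mkAlgHom_rel K (Rel.comm (𝒱 := 𝒱) hx hy)
  rw [map_smul, map_mul, map_mul] at h
  exact h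

variable (𝒱) in
/-- The values of `f` satisfy graded commutativity: `f x f y = (-1)^{ij} f y f x` for `x ∈ Vⁱ` and
`y ∈ Vʲ`. -/
def GradedCommutes {A : Type u} [Ring A] [Algebra K A] (f : V →ₗ[K] A) : Prop :=
  ∀ (i j : ℤ) (x y : V), x ∈ 𝒱 i → y ∈ 𝒱 j → f x * f y = (-1 : K) ^ (i * j) • (f y * f x)

/-- The universal property of `S V`: a linear map to an associative algebra whose values satisfy
graded commutativity extends to an algebra morphism. -/
def lift {A : Type u} [Ring A] [Algebra K A] (f : V →ₗ[K] A) (hf : GradedCommutes 𝒱 f) :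
    Sym 𝒱 →ₐ[K] A :=
  RingQuot.liftAlgHom K ⟨TensorAlgebra.lift K f, by
    rintro _ _ ⟨hx, hy⟩
    rw [map_smul, map_mul, map_mul, TensorAlgebra.lift_ι_apply,
      TensorAlgebra.lift_ι_apply, hf _ _ _ _ hx hy]⟩

@[simp]
theorem lift_ι {A : Type u} [Ring A] [Algebra K A] (f : V →ₗ[K] A)
    (hf : GradedCommutes 𝒱 f) (v : V) : lift f hf (ι 𝒱 v) = f v :=
  (RingQuot.liftAlgHom_mkAlgHom_apply K _ _ _).trans (TensorAlgebra.lift_ι_apply _ _)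

theorem algHom_ext {A : Type u} [Ring A] [Algebra K A] {f g : Sym 𝒱 →ₐ[K] A}
    (h : ∀ v, f (ι 𝒱 v) = g (ι 𝒱 v)) : f = g := by
  apply RingQuot.ringQuot_ext'
  apply TensorAlgebra.hom_ext
  ext v
  exact h v

variable (𝒱)

/-- The component of degree `n` of `S V`, for the grading induced by the one of `V`: it is spanned
by the products `v₁ ⊙ ⋯ ⊙ vₖ` of homogeneous elements with `deg v₁ + ⋯ + deg vₖ = n`. -/
def symGr (n : ℤ) : Submodule K (Sym 𝒱) :=
  Submodule.span K {w | ∃ l : List (ℤ × V), (∀ p ∈ l, p.2 ∈ 𝒱 p.1) ∧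
    (l.map Prod.fst).sum = n ∧ (l.map fun p => ι 𝒱 p.2).prod = w}

end Algebra

section Corestriction

variable (B : V →ₗ[K] V →ₗ[K] V)

/-- Auxiliary operators on `K × V × V`: `T_v (c, u, w) = (0, c • v, B v u)`. The product
`T_{v₁} ⋯ T_{vₙ}` sends `(1, 0, 0)` to `(0, v₁, 0)` if `n = 1`, to `(0, 0, B v₁ v₂)` if `n = 2`,
and to `0` if `n ≥ 3`. -/
def corestrictionOp : V →ₗ[K] Module.End K (K × V × V) where
  toFun v := LinearMap.prod 0 (LinearMap.prod ((LinearMap.fst K K (V × V)).smulRight v)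
    (B v ∘ₗ LinearMap.fst K V V ∘ₗ LinearMap.snd K K (V × V)))
  map_add' _ _ := LinearMap.ext fun _ => by simp
  map_smul' r v := LinearMap.ext fun c => by
    simpa using smul_comm c.1 r v

@[simp]
theorem corestrictionOp_apply (v : V) (c : K × V × V) :
    corestrictionOp B v c = (0, c.1 • v, B v c.2.1) := rfl

variable {𝒱 : ℤ → Submodule K V}

/-- Graded symmetry of a bilinear map: `B x y = (-1)^{ij} B y x` for `x ∈ Vⁱ` and `y ∈ Vʲ`. -/
def GradedSymmetric (𝒱 : ℤ → Submodule K V) (B : V →ₗ[K] V →ₗ[K] V) : Prop :=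
  ∀ (i j : ℤ) (x y : V), x ∈ 𝒱 i → y ∈ 𝒱 j → B x y = (-1 : K) ^ (i * j) • B y x

variable {B}

theorem corestrictionOp_comm (hB : GradedSymmetric 𝒱 B) :
    GradedCommutes 𝒱 (corestrictionOp B) := fun i j x y hx hy => LinearMap.ext fun c => by
  simpa [hB i j x y hx hy] using smul_comm _ _ _

/-- The linear map `S V → V` whose components are `0` on `V^{⊙ 0}`, `f` on `V^{⊙ 1}`, the
graded symmetric bilinear map `B` on `V^{⊙ 2}`, and `0` on `V^{⊙ n}` for `n ≥ 3`. -/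
def corestriction (f : V →ₗ[K] V) (hB : GradedSymmetric 𝒱 B) : Sym 𝒱 →ₗ[K] V :=
  (f ∘ₗ LinearMap.fst K V V + LinearMap.snd K V V) ∘ₗ LinearMap.snd K K (V × V) ∘ₗ
    LinearMap.applyₗ (R := K) ((1, 0, 0) : K × V × V) ∘ₗ
    (lift (corestrictionOp B) (corestrictionOp_comm hB)).toLinearMap

variable (f : V →ₗ[K] V) (hB : GradedSymmetric 𝒱 B)

theorem corestriction_one : corestriction f hB 1 = 0 := by
  simp [corestriction]

theorem corestriction_ι (v : V) : corestriction f hB (ι 𝒱 v) = f v := by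
  simp [corestriction]

theorem corestriction_ι_mul_ι (v w : V) :
    corestriction f hB (ι 𝒱 v * ι 𝒱 w) = B v w := by
  simp [corestriction]

theorem corestriction_ι_mul_ι_mul_ι_mul (u v w : V) (z : Sym 𝒱) :
    corestriction f hB (ι 𝒱 u * ι 𝒱 v * ι 𝒱 w * z) = 0 := by
  simp [corestriction]

variable (𝒱)

/-- The projection `p : S V → V^{⊙ 1} = V`. -/
def proj : Sym 𝒱 →ₗ[K] V :=
  corestriction (𝒱 := 𝒱) (B := 0) LinearMap.id (fun _ _ _ _ _ _ => by simp)

end Corestriction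

section Coalgebra

variable (𝒱 : ℤ → Submodule K V) [DirectSum.Decomposition 𝒱]

/-- The sign operator on `V` which multiplies `Vⁱ` by `(-1)^{n i}`. -/
def signV (n : ℤ) : V →ₗ[K] V :=
  DirectSum.toModule K ℤ V (fun i => (-1 : K) ^ (n * i) • (𝒱 i).subtype) ∘ₗ
    (DirectSum.decomposeLinearEquiv 𝒱).toLinearMap

variable {𝒱}

theorem signV_of_mem (n : ℤ) {i : ℤ} {v : V} (hv : v ∈ 𝒱 i) :
    signV 𝒱 n v = (-1 : K) ^ (n * i) • v := by
  rw [signV, LinearMap.comp_apply, LinearEquiv.coe_coe, DirectSum.decomposeLinearEquiv_apply,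
    DirectSum.decompose_of_mem 𝒱 hv, ← DirectSum.lof_eq_of K, DirectSum.toModule_lof]
  rfl

theorem signV_comm (n : ℤ) : GradedCommutes 𝒱 (ι 𝒱 ∘ₗ signV 𝒱 n) := fun i j x y hx hy => by
  simp only [LinearMap.comp_apply, signV_of_mem n hx, signV_of_mem n hy, map_smul,
    smul_mul_smul_comm, ι_mul_ι hx hy, smul_smul]
  congr 1
  ring

variable (𝒱)

/-- The sign operator on `S V` which multiplies the component of degree `m` by `(-1)^{n m}`:
the algebra morphism extending `signV`. -/
def sign (n : ℤ) : Sym 𝒱 →ₐ[K] Sym 𝒱 :=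
  lift (ι 𝒱 ∘ₗ signV 𝒱 n) (signV_comm n)

/-- The operator `a ⊗ b ↦ (1 ⊗ v) · (a ⊗ b) = (-1)^{deg v deg a} a ⊗ (v ⊙ b)` on `S V ⊗ S V`,
for `v ∈ V` (extended linearly from homogeneous `v`). -/
def mulRightFactor : V →ₗ[K] Module.End K (Sym 𝒱 ⊗[K] Sym 𝒱) :=
  DirectSum.toModule K ℤ (Module.End K (Sym 𝒱 ⊗[K] Sym 𝒱)) (fun i =>
      TensorProduct.mapBilinear (RingHom.id K) (Sym 𝒱) (Sym 𝒱) (Sym 𝒱) (Sym 𝒱)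
        (sign 𝒱 i).toLinearMap ∘ₗ LinearMap.mul K (Sym 𝒱) ∘ₗ ι 𝒱 ∘ₗ (𝒱 i).subtype) ∘ₗ
    (DirectSum.decomposeLinearEquiv 𝒱).toLinearMap

variable {𝒱}

theorem signV_signV (m n : ℤ) (v : V) :
    signV 𝒱 m (signV 𝒱 n v) = signV 𝒱 n (signV 𝒱 m v) := by
  induction v using DirectSum.Decomposition.inductionOn 𝒱 with
  | zero => simp
  | @homogeneous i v =>
    rw [signV_of_mem n v.2, signV_of_mem m v.2, map_smul, map_smul, signV_of_mem n v.2,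
      signV_of_mem m v.2]
    exact smul_comm _ _ _
  | add v w hv hw => simp only [map_add, hv, hw]

theorem sign_ι (n : ℤ) (v : V) : sign 𝒱 n (ι 𝒱 v) = ι 𝒱 (signV 𝒱 n v) :=
  lift_ι _ _ v

theorem sign_sign (m n : ℤ) (w : Sym 𝒱) :
    sign 𝒱 m (sign 𝒱 n w) = sign 𝒱 n (sign 𝒱 m w) :=
  DFunLike.congr_fun (algHom_ext (f := (sign 𝒱 m).comp (sign 𝒱 n))
    (g := (sign 𝒱 n).comp (sign 𝒱 m)) fun v => by
      simp only [AlgHom.comp_apply, sign_ι, signV_signV m n]) w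

theorem mulRightFactor_tmul {i : ℤ} {v : V} (hv : v ∈ 𝒱 i) (a b : Sym 𝒱) :
    mulRightFactor 𝒱 v (a ⊗ₜ b) = sign 𝒱 i a ⊗ₜ (ι 𝒱 v * b) := by
  rw [mulRightFactor, LinearMap.comp_apply, LinearEquiv.coe_coe,
    DirectSum.decomposeLinearEquiv_apply, DirectSum.decompose_of_mem 𝒱 hv,
    ← DirectSum.lof_eq_of K, DirectSum.toModule_lof]
  rfl

variable (𝒱)

/-- Left multiplication by `v ⊗ 1 + 1 ⊗ v` on `S V ⊗ S V`, whose product is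
`(a ⊗ b) (a' ⊗ b') = (-1)^{deg b deg a'} (a ⊙ a') ⊗ (b ⊙ b')`. -/
def comulOp : V →ₗ[K] Module.End K (Sym 𝒱 ⊗[K] Sym 𝒱) :=
  LinearMap.rTensorHom (Sym 𝒱) ∘ₗ LinearMap.mul K (Sym 𝒱) ∘ₗ ι 𝒱 + mulRightFactor 𝒱

variable {𝒱}

theorem comulOp_tmul {i : ℤ} {v : V} (hv : v ∈ 𝒱 i) (a b : Sym 𝒱) :
    comulOp 𝒱 v (a ⊗ₜ b) = (ι 𝒱 v * a) ⊗ₜ b + sign 𝒱 i a ⊗ₜ (ι 𝒱 v * b) := by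
  rw [← mulRightFactor_tmul hv]
  rfl

theorem comulOp_comm : GradedCommutes (A := Module.End K (Sym 𝒱 ⊗[K] Sym 𝒱)) 𝒱 (comulOp 𝒱) := fun i j x y hx hy => by
  have hs : (-1 : K) ^ (i * j) * (-1 : K) ^ (i * j) = 1 := by
    rw [← mul_zpow, neg_one_mul, neg_neg, one_zpow]
  refine TensorProduct.ext' fun a b => ?_
  simp only [Module.End.mul_apply, LinearMap.smul_apply, comulOp_tmul hx, comulOp_tmul hy,
    map_add, map_mul, sign_ι, signV_of_mem _ hx, signV_of_mem _ hy, sign_sign i j, map_smul,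
    ← mul_assoc, ι_mul_ι hx hy, mul_comm j i, smul_mul_assoc, ← TensorProduct.smul_tmul',
    TensorProduct.tmul_smul, smul_add, smul_smul, hs, one_smul]
  abel

variable (𝒱)

/-- The coproduct `Δ : S V → S V ⊗ S V`, that is, the morphism of graded algebras such that
`Δ v = v ⊗ 1 + 1 ⊗ v` for `v ∈ V`:
`Δ (v₁ ⊙ ⋯ ⊙ vₙ) = (v₁ ⊗ 1 + 1 ⊗ v₁) ⋯ (vₙ ⊗ 1 + 1 ⊗ vₙ)
  = ∑ₖ ∑_{σ ∈ S(k, n-k)} ε(σ) (v_σ(1) ⊙ ⋯ ⊙ v_σ(k)) ⊗ (v_σ(k+1) ⊙ ⋯ ⊙ v_σ(n))`,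
the inner sum being over the unshuffles of type `(k, n-k)`, with Koszul signs. -/
def comul : Sym 𝒱 →ₗ[K] Sym 𝒱 ⊗[K] Sym 𝒱 :=
  LinearMap.applyₗ (R := K) ((1 : Sym 𝒱) ⊗ₜ[K] (1 : Sym 𝒱)) ∘ₗ
    (lift (A := Module.End K (Sym 𝒱 ⊗[K] Sym 𝒱)) (comulOp 𝒱) comulOp_comm).toLinearMap

theorem comul_one : comul 𝒱 1 = 1 ⊗ₜ 1 := by
  simp [comul]

theorem comul_ι_mul (v : V) (w : Sym 𝒱) : comul 𝒱 (ι 𝒱 v * w) = comulOp 𝒱 v (comul 𝒱 w) := by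
  simp [comul, lift_ι]

/-- `Coderⁿ(S V)`: the coderivations of degree `n`, i.e. the linear maps `α : S V → S V` of degree
`n` such that `Δ α = (α ⊗ id + id ⊗ α) Δ`, where `(id ⊗ α) (a ⊗ b) = (-1)^{n deg a} a ⊗ α b`. -/
def coder (n : ℤ) : Submodule K (Module.End K (Sym 𝒱)) where
  carrier := {α | (∀ m : ℤ, ∀ w ∈ symGr 𝒱 m, α w ∈ symGr 𝒱 (m + n)) ∧
    comul 𝒱 ∘ₗ α = (TensorProduct.map α LinearMap.id +
      TensorProduct.map (sign 𝒱 n).toLinearMap α) ∘ₗ comul 𝒱}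
  zero_mem' := ⟨fun _ _ _ => Submodule.zero_mem _, by simp⟩
  add_mem' {α β} hα hβ := ⟨fun m w hw => Submodule.add_mem _ (hα.1 m w hw) (hβ.1 m w hw), by
    rw [LinearMap.comp_add, hα.2, hβ.2, TensorProduct.map_add_left, TensorProduct.map_add_right,
      ← LinearMap.add_comp]
    congr 1
    abel⟩
  smul_mem' c α hα := ⟨fun m w hw => Submodule.smul_mem _ c (hα.1 m w hw), by
    rw [LinearMap.comp_smul, hα.2, TensorProduct.map_smul_left, TensorProduct.map_smul_right,
      ← smul_add, LinearMap.smul_comp]⟩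

/-- The coderivation of `S V` with corestriction `q : S V → V`, i.e. the map
`v₁ ⊙ ⋯ ⊙ vₙ ↦ ∑ₖ ∑_{σ ∈ S(k, n-k)} ε(σ) q(v_σ(1) ⊙ ⋯ ⊙ v_σ(k)) ⊙ v_σ(k+1) ⊙ ⋯ ⊙ v_σ(n)`. -/
def coderOfCorestriction (q : Sym 𝒱 →ₗ[K] V) : Module.End K (Sym 𝒱) :=
  LinearMap.mul' K (Sym 𝒱) ∘ₗ TensorProduct.map (ι 𝒱 ∘ₗ q) LinearMap.id ∘ₗ comul 𝒱

end Coalgebra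

end GradedSym

/-! ## The DG-coalgebra `S L[1]` of a DG-Lie algebra and its coderivations -/

namespace DGLieAlgebra

open GradedSym

variable {K : Type u} [Field K] (L : DGLieAlgebra K)

/-- The grading of the shift `L[1]`, which has the same underlying vector space as `L`:
`L[1]ⁱ = Lⁱ⁺¹`. -/
def shiftGr (i : ℤ) : Submodule K L.carrier := L.gr (i + 1)

theorem shiftGr_isInternal : DirectSum.IsInternal L.shiftGr := by
  have h := (DirectSum.isInternal_submodule_iff_iSupIndep_and_iSup_eq_top _).1 L.isInternal
  rw [DirectSum.isInternal_submodule_iff_iSupIndep_and_iSup_eq_top]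
  refine ⟨h.1.comp (add_left_injective (1 : ℤ)), ?_⟩
  rw [← h.2]
  exact (Equiv.addRight (1 : ℤ)).iSup_comp (g := L.gr)

noncomputable instance : DirectSum.Decomposition L.shiftGr :=
  L.shiftGr_isInternal.chooseDecomposition

/-- The underlying vector space of the symmetric coalgebra `S L[1]`. -/
abbrev SymShift : Type u := Sym L.shiftGr

/-- `q₁ (x) = - d x`, the differential of `L[1]`. -/
def q₁ : L.carrier →ₗ[K] L.carrier := -L.d

/-- `q₂ (x ⊙ y) = - (-1)^i [x, y]` for `x ∈ L[1]ⁱ` and `y ∈ L[1]`. -/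
noncomputable def q₂ : L.carrier →ₗ[K] L.carrier →ₗ[K] L.carrier :=
  -(L.bracket ∘ₗ signV L.shiftGr 1)

theorem q₂_of_mem {i : ℤ} {x : L.carrier} (hx : x ∈ L.shiftGr i) (y : L.carrier) :
    L.q₂ x y = -((-1 : K) ^ i • L.bracket x y) := by
  simp only [q₂, LinearMap.neg_apply, LinearMap.comp_apply, signV_of_mem 1 hx, one_mul,
    map_smul, LinearMap.smul_apply]

theorem q₂_symm : GradedSymmetric L.shiftGr L.q₂ := fun i j x y hx hy => by
  have h1 : (-1 : K) ≠ 0 := neg_ne_zero.2 one_ne_zero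
  have h2 : (-1 : K) ^ i * (-1 : K) ^ i = 1 := by
    rw [← mul_zpow, neg_one_mul, neg_neg, one_zpow]
  rw [q₂_of_mem L hx, q₂_of_mem L hy, L.skew (show x ∈ L.gr (i + 1) from hx)
    (show y ∈ L.gr (j + 1) from hy), smul_neg, neg_neg, smul_neg, smul_smul, smul_smul,
    ← neg_smul]
  congr 1
  rw [show (i + 1) * (j + 1) = i * j + i + j + 1 by ring, zpow_add₀ h1, zpow_add₀ h1,
    zpow_add₀ h1, zpow_one]
  linear_combination (-(-1 : K) ^ (i * j) * (-1 : K) ^ j) * h2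

/-- The codifferential `Q` of `S L[1]`: the coderivation whose corestriction `S L[1] → L[1]` has
components `q₁` on `L[1]`, `q₂` on `L[1]^{⊙ 2}` and zero elsewhere. Explicitly,
`Q (v₁ ⊙ ⋯ ⊙ vₙ) = ∑_{k = 1, 2} ∑_{σ ∈ S(k, n-k)}
  ε(σ) qₖ(v_σ(1) ⊙ ⋯ ⊙ v_σ(k)) ⊙ v_σ(k+1) ⊙ ⋯ ⊙ v_σ(n)`. -/
noncomputable def Q : Module.End K L.SymShift :=
  coderOfCorestriction L.shiftGr (corestriction L.q₁ L.q₂_symm)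

/-- `Coderⁿ(S L[1])`. -/
noncomputable def coder (n : ℤ) : Submodule K (Module.End K L.SymShift) :=
  GradedSym.coder L.shiftGr n

/-- The differential `[Q, α] = Q α - (-1)ⁿ α Q` of `Coder^*(S L[1])`, on elements `α` of
degree `n`. -/
noncomputable def coderD (n : ℤ) (α : Module.End K L.SymShift) : Module.End K L.SymShift :=
  L.Q * α - (-1 : K) ^ n • (α * L.Q)

/-- The evaluation map `b : Coder^*(S L[1]) → L[1]`, `b α = p (α 1)`. -/
noncomputable def b (α : Module.End K L.SymShift) : L.carrier :=
  proj L.shiftGr (α 1)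

/-- The splitting property: the morphism of DG-vector spaces
`b : (Coder^*(S L[1]), [Q, ]) → (L[1], q₁)` is surjective in cohomology, that is, in every degree
`n`, every cocycle `x` of `L[1]` is cohomologous to `b α` for some cocycle `α`. -/
def HasSplittingProperty : Prop :=
  ∀ n : ℤ, ∀ x ∈ L.shiftGr n, L.q₁ x = 0 →
    ∃ α ∈ L.coder n, L.coderD n α = 0 ∧ ∃ y ∈ L.shiftGr (n - 1), L.b α = x + L.q₁ y

end DGLieAlgebra

/-!
Homotopy abelianity of a DG-Lie algebra with the splitting property.

Let `D = Coder^*(S L[1])` and let `D₀ ⊆ D` be the DG-Lie subalgebra of the coderivations that kill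
`1`. For a coderivation `α`, the element `α 1` is primitive, hence equal to `b α ∈ L[1]`
(`GradedSym.coder_apply_one`; this uses characteristic zero, as does the integration below). So
`D / D₀ ≅ L[1]` through `b`, and the homotopy fibre of `D₀ ⊆ D` is a model of `L`, while the
splitting property says that `H(D) → H(D / D₀)` is surjective.

The homotopy fibre of `N ⊆ X` is modelled by the polynomial paths `f(t) + dt g(t)` in `X[t, dt]`
with `f(0) = 0` and `f(1) ∈ N` (`DGLiePieces.fiber`); its cohomology is the one of `(X / N)[-1]`,
through `f + dt g ↦ ∫₀¹ g`.

* The inclusion of `L` in its acyclic cone `L ⊕ ε L`, where `d ε = 1`, has a fibre quasi-isomorphic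
  to `L` through `f ↦ f(1)` (`DGLieAlgebra.coneFiberEval_isQuasiIso`).
* For `x ∈ L`, let `ad x` be the coderivation with corestriction `q₂ (x ⊙ ·)` and let `i x` be the
  multiplication by `x`, again a coderivation. The Cartan formulas `[Q, i x] = ad x - i (d x)`,
  `[i x, ad y] = i [x, y]`, `[i x, i y] = 0` say that `x + ε y ↦ ad x + i y` is a morphism
  `L ⊕ ε L → D` (`DGLieAlgebra.coneToCoder`). It carries `L` into `D₀` and induces an isomorphism
  on the quotients, hence a quasi-isomorphism on the fibres.
* In the fibre of `D₀ ⊆ D`, the elements `dt α` with `α` a cocycle of `D` span an abelian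
  subalgebra with zero differential, because `dt² = 0`. When `H(D) → H(D / D₀)` is surjective, a
  suitable space of such cocycles represents each class of the fibre exactly once
  (`DGLiePieces.exists_abelian_quasiIso_fiber`).

The resulting zigzag `L ← fibre(L ⊆ L ⊕ ε L) → fibre(D₀ ⊆ D) ← (abelian)` proves the claim.

All these DG-Lie algebras are given by their homogeneous components, as subspaces of one ambient
space with operations that may depend on the degrees; `DGLiePieces.toDGLie` assembles the
components into a `DGLieAlgebra` by taking the external direct sum.
-/

noncomputable section

/-! ### DG-Lie algebras given by homogeneous components -/

open scoped DirectSum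

/-- A graded Lie algebra given by its homogeneous components `P n`, which are subspaces of one
ambient space `E`. The components need not be independent in `E`, and the bracket may depend on the
degrees (through signs): `br m n` is meaningful on `P m × P n` only. -/
structure GradedLiePieces (K : Type u) [Field K] : Type (u + 1) where
  E : Type u
  [addCommGroup : AddCommGroup E]
  [module : Module K E]
  P : ℤ → Submodule K E
  br : ℤ → ℤ → E →ₗ[K] E →ₗ[K] E
  br_mem : ∀ {i j : ℤ} {x y : E}, x ∈ P i → y ∈ P j → br i j x y ∈ P (i + j)
  skew : ∀ {i j : ℤ} {x y : E}, x ∈ P i → y ∈ P j →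
    br i j x y = -((-1 : K) ^ (i * j) • br j i y x)
  jacobi : ∀ {i j k : ℤ} {x y z : E}, x ∈ P i → y ∈ P j → z ∈ P k →
    br i (j + k) x (br j k y z) =
      br (i + j) k (br i j x y) z + (-1 : K) ^ (i * j) • br j (i + k) y (br i k x z)

attribute [instance] GradedLiePieces.addCommGroup GradedLiePieces.module

/-- A graded Lie algebra given by homogeneous components, with a differential: `d n` is meaningful
on `P n` only. -/
structure DGLiePieces (K : Type u) [Field K] : Type (u + 1) extends GradedLiePieces K where
  d : ℤ → E →ₗ[K] E
  d_mem : ∀ {i : ℤ} {x : E}, x ∈ P i → d i x ∈ P (i + 1)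
  d_d : ∀ {i : ℤ} {x : E}, x ∈ P i → d (i + 1) (d i x) = 0
  leibniz : ∀ {i j : ℤ} {x y : E}, x ∈ P i → y ∈ P j →
    d (i + j) (br i j x y) = br (i + 1) j (d i x) y + (-1 : K) ^ i • br i (j + 1) x (d j y)

namespace DGLiePieces

variable {K : Type u} [Field K]

section Tot

variable (X : DGLiePieces K)

/-- The external direct sum of the homogeneous components. -/
abbrev TotCarrier : Type u := ⨁ n, X.P n

/-- The element of the direct sum given by an element of the component of degree `n`. -/
def tot {n : ℤ} (x : X.E) (hx : x ∈ X.P n) : X.TotCarrier :=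
  DirectSum.lof K ℤ (fun n => X.P n) n ⟨x, hx⟩

variable {X}

theorem tot_congr {m n : ℤ} {x y : X.E} (hx : x ∈ X.P m) (hy : y ∈ X.P n) (hmn : m = n)
    (hxy : x = y) : X.tot x hx = X.tot y hy := by
  subst hmn; subst hxy; rfl

theorem tot_add {n : ℤ} {x y : X.E} (hx : x ∈ X.P n) (hy : y ∈ X.P n) :
    X.tot x hx + X.tot y hy = X.tot (x + y) (add_mem hx hy) := by
  rw [tot, tot, tot, ← map_add]; rfl

theorem tot_smul {n : ℤ} {x : X.E} (hx : x ∈ X.P n) (c : K) :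
    c • X.tot x hx = X.tot (c • x) (Submodule.smul_mem _ c hx) := by
  rw [tot, tot, ← map_smul]; rfl

theorem tot_neg {n : ℤ} {x : X.E} (hx : x ∈ X.P n) :
    - X.tot x hx = X.tot (-x) (neg_mem hx) := by
  rw [tot, tot, ← map_neg]; rfl

theorem tot_zero {n : ℤ} : X.tot (0 : X.E) (zero_mem (X.P n)) = 0 :=
  map_zero (DirectSum.lof K ℤ (fun n => X.P n) n)

theorem tot_injective {n : ℤ} {x y : X.E} (hx : x ∈ X.P n) (hy : y ∈ X.P n)
    (h : X.tot x hx = X.tot y hy) : x = y := by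
  have := congrArg (DirectSum.component K ℤ (fun n => X.P n) n) h
  rw [tot, tot, DirectSum.component.lof_self, DirectSum.component.lof_self] at this
  exact congrArg Subtype.val this

theorem tot_induction {p : X.TotCarrier → Prop} (z : X.TotCarrier)
    (h : ∀ (n : ℤ) (x : X.E) (hx : x ∈ X.P n), p (X.tot x hx))
    (hadd : ∀ a b, p a → p b → p (a + b)) : p z := by
  induction z using DirectSum.induction_on with
  | zero => rw [← tot_zero (X := X) (n := 0)]; exact h _ _ _
  | of i x => exact h i x.1 x.2
  | add a b ha hb => exact hadd a b ha hb

variable (X)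

/-- The component of degree `n` of the direct sum. -/
def totGr (n : ℤ) : Submodule K X.TotCarrier :=
  LinearMap.range (DirectSum.lof K ℤ (fun n => X.P n) n)

variable {X}

theorem mem_totGr {n : ℤ} {z : X.TotCarrier} :
    z ∈ X.totGr n ↔ ∃ (x : X.E) (hx : x ∈ X.P n), z = X.tot x hx := by
  constructor
  · rintro ⟨⟨x, hx⟩, rfl⟩; exact ⟨x, hx, rfl⟩
  · rintro ⟨x, hx, rfl⟩; exact ⟨⟨x, hx⟩, rfl⟩

theorem tot_mem {n : ℤ} {x : X.E} (hx : x ∈ X.P n) : X.tot x hx ∈ X.totGr n :=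
  mem_totGr.2 ⟨x, hx, rfl⟩

variable (X)

theorem totGr_isInternal : DirectSum.IsInternal X.totGr := by
  apply DirectSum.isInternal_submodule_of_iSupIndep_of_iSup_eq_top
  · rw [iSupIndep_def]
    intro i
    rw [Submodule.disjoint_def]
    intro z hz hz'
    have hle : ⨆ j, ⨆ (_ : j ≠ i), X.totGr j ≤
        LinearMap.ker (DirectSum.component K ℤ (fun n => X.P n) i) := by
      refine iSup₂_le fun j hj => ?_
      rintro _ ⟨x, rfl⟩
      rw [LinearMap.mem_ker, DirectSum.component.of, dif_neg hj]
    obtain ⟨x, rfl⟩ := hz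
    have := hle hz'
    rw [LinearMap.mem_ker, DirectSum.component.lof_self] at this
    rw [this, map_zero]
  · rw [eq_top_iff]
    intro z _
    induction z using tot_induction with
    | h n x hx => exact Submodule.mem_iSup_of_mem n (tot_mem hx)
    | hadd a b ha hb => exact add_mem (ha trivial) (hb trivial)

/-- The differential of the direct sum. -/
def totD : X.TotCarrier →ₗ[K] X.TotCarrier :=
  DirectSum.toModule K ℤ _ fun i => DirectSum.lof K ℤ (fun n => X.P n) (i + 1) ∘ₗ
    (X.d i).restrict fun _ hx => X.d_mem hx

/-- The bracket between two homogeneous components. -/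
def brPiece (i j : ℤ) : X.P i →ₗ[K] X.P j →ₗ[K] X.P (i + j) :=
  LinearMap.mk₂ K (fun x y => ⟨X.br i j x y, X.br_mem x.2 y.2⟩)
    (fun _ _ _ => Subtype.ext (by simp)) (fun _ _ _ => Subtype.ext (by simp))
    (fun _ _ _ => Subtype.ext (by simp)) (fun _ _ _ => Subtype.ext (by simp))

/-- The bracket of the direct sum. -/
def totBracket : X.TotCarrier →ₗ[K] X.TotCarrier →ₗ[K] X.TotCarrier :=
  DirectSum.toModule K ℤ _ fun i => LinearMap.flip <|
    DirectSum.toModule K ℤ _ fun j => LinearMap.flip <|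
      (X.brPiece i j).compr₂ (DirectSum.lof K ℤ (fun n => X.P n) (i + j))

variable {X}

theorem totD_tot {n : ℤ} {x : X.E} (hx : x ∈ X.P n) :
    X.totD (X.tot x hx) = X.tot (X.d n x) (X.d_mem hx) := by
  rw [totD, tot, DirectSum.toModule_lof]; rfl

theorem totBracket_tot {m n : ℤ} {x y : X.E} (hx : x ∈ X.P m) (hy : y ∈ X.P n) :
    X.totBracket (X.tot x hx) (X.tot y hy) = X.tot (X.br m n x y) (X.br_mem hx hy) := by
  rw [totBracket, tot, DirectSum.toModule_lof, tot, LinearMap.flip_apply,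
    DirectSum.toModule_lof]
  rfl

variable (X)

/-- The DG-Lie algebra with the given homogeneous components. -/
def toDGLie : DGLieAlgebra K where
  carrier := X.TotCarrier
  gr := X.totGr
  isInternal := X.totGr_isInternal
  d := X.totD
  d_mem := by
    intro i z hz
    obtain ⟨x, hx, rfl⟩ := mem_totGr.1 hz
    rw [totD_tot]; exact tot_mem _
  d_d := by
    intro z
    induction z using tot_induction with
    | h n x hx =>
      rw [totD_tot, totD_tot, ← tot_zero (X := X) (n := n + 1 + 1)]
      exact tot_congr _ _ rfl (X.d_d hx)
    | hadd a b ha hb => rw [map_add, map_add, ha, hb, add_zero]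
  bracket := X.totBracket
  bracket_mem := by
    intro i j z w hz hw
    obtain ⟨x, hx, rfl⟩ := mem_totGr.1 hz
    obtain ⟨y, hy, rfl⟩ := mem_totGr.1 hw
    rw [totBracket_tot]; exact tot_mem _
  skew := by
    intro i j z w hz hw
    obtain ⟨x, hx, rfl⟩ := mem_totGr.1 hz
    obtain ⟨y, hy, rfl⟩ := mem_totGr.1 hw
    rw [totBracket_tot, totBracket_tot, tot_smul, tot_neg]
    exact tot_congr _ _ (add_comm _ _) (X.skew hx hy)
  jacobi := by
    intro i j z w v hz hw
    obtain ⟨x, hx, rfl⟩ := mem_totGr.1 hz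
    obtain ⟨y, hy, rfl⟩ := mem_totGr.1 hw
    induction v using tot_induction with
    | h k v hv =>
      rw [totBracket_tot hy hv, totBracket_tot hx, totBracket_tot hx hy, totBracket_tot _ hv,
        totBracket_tot hx hv, totBracket_tot hy, tot_smul,
        tot_congr (Submodule.smul_mem _ _ (X.br_mem hy (X.br_mem hx hv)))
          (show _ ∈ X.P (i + j + k) from
            (show j + (i + k) = i + j + k by ring) ▸
              Submodule.smul_mem _ _ (X.br_mem hy (X.br_mem hx hv))) (by ring) rfl, tot_add]
      exact tot_congr _ _ (by ring) (X.jacobi hx hy hv)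
    | hadd a b ha hb =>
      simp only [map_add, ha, hb, smul_add]
      abel
  leibniz := by
    intro i z v hz
    obtain ⟨x, hx, rfl⟩ := mem_totGr.1 hz
    induction v using tot_induction with
    | h k v hv =>
      rw [totBracket_tot hx hv, totD_tot, totD_tot, totD_tot, totBracket_tot _ hv,
        totBracket_tot hx, tot_smul,
        tot_congr (Submodule.smul_mem _ _ (X.br_mem hx (X.d_mem hv)))
          (show _ ∈ X.P (i + 1 + k) from
            (show i + (k + 1) = i + 1 + k by ring) ▸
              Submodule.smul_mem _ _ (X.br_mem hx (X.d_mem hv))) (by ring) rfl, tot_add]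
      exact tot_congr _ _ (by ring) (X.leibniz hx hv)
    | hadd a b ha hb =>
      simp only [map_add, ha, hb, smul_add]
      abel

end Tot

end DGLiePieces

namespace DGLieAlgebra

variable {K : Type u} [Field K]

/-- Being a quasi-isomorphism, in terms of cocycles and coboundaries. -/
theorem Hom.isQuasiIso_of {L M : DGLieAlgebra K} (f : Hom L M)
    (surj : ∀ (n : ℤ) (y : M.carrier), y ∈ M.gr n → M.d y = 0 →
      ∃ x ∈ L.gr n, L.d x = 0 ∧ ∃ z ∈ M.gr (n - 1), f.toLinearMap x = y + M.d z)
    (inj : ∀ (n : ℤ) (x : L.carrier), x ∈ L.gr n → L.d x = 0 →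
      (∃ z ∈ M.gr (n - 1), f.toLinearMap x = M.d z) → ∃ z ∈ L.gr (n - 1), x = L.d z) :
    f.IsQuasiIso := by
  intro n
  constructor
  · rw [injective_iff_map_eq_zero]
    intro a ha
    obtain ⟨⟨x, hx, hdx⟩, rfl⟩ := Submodule.Quotient.mk_surjective _ a
    have ha' : (Submodule.Quotient.mk (f.cocyclesMap n ⟨x, hx, hdx⟩) : M.Cohomology n) = 0 := ha
    rw [Submodule.Quotient.mk_eq_zero] at ha' ⊢
    obtain ⟨z, hz, hzx⟩ := ha'
    obtain ⟨w, hw, hwx⟩ := inj n x hx hdx ⟨z, hz, hzx.symm⟩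
    exact ⟨w, hw, hwx.symm⟩
  · intro a
    obtain ⟨⟨y, hy, hdy⟩, rfl⟩ := Submodule.Quotient.mk_surjective _ a
    obtain ⟨x, hx, hdx, z, hz, h⟩ := surj n y hy hdy
    refine ⟨Submodule.Quotient.mk ⟨x, hx, hdx⟩, ?_⟩
    change (Submodule.Quotient.mk (f.cocyclesMap n ⟨x, hx, hdx⟩) : M.Cohomology n) = _
    rw [Submodule.Quotient.eq]
    refine ⟨z, hz, ?_⟩
    change M.d z = f.toLinearMap x - y
    rw [h]; abel

end DGLieAlgebra

namespace DGLiePieces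

variable {K : Type u} [Field K]

/-- Morphisms, induced by a linear map between the ambient spaces. -/
structure Hom (X Y : DGLiePieces K) where
  φ : X.E →ₗ[K] Y.E
  map_mem : ∀ {n : ℤ} {x : X.E}, x ∈ X.P n → φ x ∈ Y.P n
  map_d : ∀ {n : ℤ} {x : X.E}, x ∈ X.P n → φ (X.d n x) = Y.d n (φ x)
  map_br : ∀ {m n : ℤ} {x y : X.E}, x ∈ X.P m → y ∈ X.P n →
    φ (X.br m n x y) = Y.br m n (φ x) (φ y)

namespace Hom

variable {X Y : DGLiePieces K} (f : Hom X Y)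

/-- The map induced on direct sums. -/
def totMap : X.TotCarrier →ₗ[K] Y.TotCarrier :=
  DirectSum.lmap fun _ => f.φ.restrict fun _ hx => f.map_mem hx

theorem totMap_tot {n : ℤ} {x : X.E} (hx : x ∈ X.P n) :
    f.totMap (X.tot x hx) = Y.tot (f.φ x) (f.map_mem hx) := by
  rw [totMap, tot, DirectSum.lmap_lof]; rfl

theorem totMap_totD (z : X.TotCarrier) : f.totMap (X.totD z) = Y.totD (f.totMap z) := by
  induction z using tot_induction with
  | h n x hx =>
    rw [totD_tot, totMap_tot, totMap_tot, totD_tot]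
    exact tot_congr _ _ rfl (f.map_d hx)
  | hadd a b ha hb => simp only [map_add, ha, hb]

theorem totMap_totBracket (z w : X.TotCarrier) :
    f.totMap (X.totBracket z w) = Y.totBracket (f.totMap z) (f.totMap w) := by
  induction z using tot_induction with
  | h n x hx =>
    induction w using tot_induction with
    | h m y hy =>
      rw [totBracket_tot, totMap_tot, totMap_tot, totMap_tot, totBracket_tot]
      exact tot_congr _ _ rfl (f.map_br hx hy)
    | hadd a b ha hb => simp only [map_add, ha, hb]
  | hadd a b ha hb => simp only [map_add, LinearMap.add_apply, ha, hb]

/-- The morphism of DG-Lie algebras induced on direct sums. -/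
def toDGLie : DGLieAlgebra.Hom X.toDGLie Y.toDGLie where
  toLinearMap := f.totMap
  map_gr := by
    intro i z hz
    obtain ⟨x, hx, rfl⟩ := mem_totGr.1 hz
    exact mem_totGr.2 ⟨_, f.map_mem hx, f.totMap_tot hx⟩
  map_d := f.totMap_totD
  map_bracket := f.totMap_totBracket

theorem toDGLie_isQuasiIso
    (surj : ∀ (n : ℤ) (y : Y.E), y ∈ Y.P n → Y.d n y = 0 →
      ∃ x ∈ X.P n, X.d n x = 0 ∧ ∃ z ∈ Y.P (n - 1), f.φ x = y + Y.d (n - 1) z)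
    (inj : ∀ (n : ℤ) (x : X.E), x ∈ X.P n → X.d n x = 0 →
      (∃ z ∈ Y.P (n - 1), f.φ x = Y.d (n - 1) z) → ∃ z ∈ X.P (n - 1), x = X.d (n - 1) z) :
    f.toDGLie.IsQuasiIso := by
  apply DGLieAlgebra.Hom.isQuasiIso_of
  · intro n z hz hdz
    obtain ⟨y, hy, rfl⟩ := mem_totGr.1 hz
    change Y.totD _ = 0 at hdz
    rw [totD_tot, ← tot_zero (X := Y) (n := n + 1)] at hdz
    obtain ⟨x, hx, hdx, z, hz, h⟩ := surj n y hy (tot_injective _ _ hdz)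
    refine ⟨X.tot x hx, tot_mem hx, ?_, Y.tot z hz, tot_mem hz, ?_⟩
    · change X.totD _ = 0
      rw [totD_tot, ← tot_zero (X := X) (n := n + 1)]
      exact tot_congr _ _ rfl hdx
    · change f.totMap _ = _ + Y.totD _
      have hm : Y.d (n - 1) z ∈ Y.P n := by simpa using Y.d_mem hz
      rw [totMap_tot, totD_tot, tot_congr (Y.d_mem hz) hm (by ring) rfl, tot_add]
      exact tot_congr _ _ rfl h
  · rintro n z hz hdz ⟨w, hw, hzw⟩
    obtain ⟨x, hx, rfl⟩ := mem_totGr.1 hz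
    obtain ⟨y, hy, rfl⟩ := mem_totGr.1 hw
    change X.totD _ = 0 at hdz
    rw [totD_tot, ← tot_zero (X := X) (n := n + 1)] at hdz
    change f.totMap _ = Y.totD _ at hzw
    have hm : Y.d (n - 1) y ∈ Y.P n := by simpa using Y.d_mem hy
    rw [totMap_tot, totD_tot, tot_congr (Y.d_mem hy) hm (by ring) rfl] at hzw
    obtain ⟨z, hz, h⟩ := inj n x hx (tot_injective _ _ hdz) ⟨y, hy, tot_injective _ _ hzw⟩
    refine ⟨X.tot z hz, tot_mem hz, ?_⟩
    change _ = X.totD _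
    rw [totD_tot]
    exact tot_congr _ _ (by ring) h

end Hom

/-- Morphisms to a DG-Lie algebra, induced by a linear map on the ambient space. -/
structure HomTo (X : DGLiePieces K) (M : DGLieAlgebra K) where
  φ : X.E →ₗ[K] M.carrier
  map_mem : ∀ {n : ℤ} {x : X.E}, x ∈ X.P n → φ x ∈ M.gr n
  map_d : ∀ {n : ℤ} {x : X.E}, x ∈ X.P n → φ (X.d n x) = M.d (φ x)
  map_br : ∀ {m n : ℤ} {x y : X.E}, x ∈ X.P m → y ∈ X.P n →
    φ (X.br m n x y) = M.bracket (φ x) (φ y)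

namespace HomTo

variable {X : DGLiePieces K} {M : DGLieAlgebra K} (f : HomTo X M)

/-- The map induced on the direct sum. -/
def totMap : X.TotCarrier →ₗ[K] M.carrier :=
  DirectSum.toModule K ℤ M.carrier fun n => f.φ ∘ₗ (X.P n).subtype

theorem totMap_tot {n : ℤ} {x : X.E} (hx : x ∈ X.P n) : f.totMap (X.tot x hx) = f.φ x := by
  rw [totMap, tot, DirectSum.toModule_lof]; rfl

theorem totMap_totD (z : X.TotCarrier) : f.totMap (X.totD z) = M.d (f.totMap z) := by
  induction z using tot_induction with
  | h n x hx => rw [totD_tot, totMap_tot, totMap_tot, f.map_d hx]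
  | hadd a b ha hb => simp only [map_add, ha, hb]

theorem totMap_totBracket (z w : X.TotCarrier) :
    f.totMap (X.totBracket z w) = M.bracket (f.totMap z) (f.totMap w) := by
  induction z using tot_induction with
  | h n x hx =>
    induction w using tot_induction with
    | h m y hy =>
      rw [totBracket_tot, totMap_tot, totMap_tot, totMap_tot, f.map_br hx hy]
    | hadd a b ha hb => simp only [map_add, ha, hb]
  | hadd a b ha hb => simp only [map_add, LinearMap.add_apply, ha, hb]

/-- The morphism of DG-Lie algebras induced on the direct sum. -/
def toDGLie : DGLieAlgebra.Hom X.toDGLie M where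
  toLinearMap := f.totMap
  map_gr := by
    intro i z hz
    obtain ⟨x, hx, rfl⟩ := mem_totGr.1 hz
    exact (f.totMap_tot hx).symm ▸ f.map_mem hx
  map_d := f.totMap_totD
  map_bracket := f.totMap_totBracket

theorem toDGLie_isQuasiIso
    (surj : ∀ (n : ℤ) (y : M.carrier), y ∈ M.gr n → M.d y = 0 →
      ∃ x ∈ X.P n, X.d n x = 0 ∧ f.φ x = y)
    (inj : ∀ (n : ℤ) (x : X.E), x ∈ X.P n → X.d n x = 0 →
      (∃ z ∈ M.gr (n - 1), f.φ x = M.d z) → ∃ z ∈ X.P (n - 1), x = X.d (n - 1) z) :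
    f.toDGLie.IsQuasiIso := by
  apply DGLieAlgebra.Hom.isQuasiIso_of
  · intro n y hy hdy
    obtain ⟨x, hx, hdx, h⟩ := surj n y hy hdy
    refine ⟨X.tot x hx, tot_mem hx, ?_, 0, zero_mem _, ?_⟩
    · change X.totD _ = 0
      rw [totD_tot, ← tot_zero (X := X) (n := n + 1)]
      exact tot_congr _ _ rfl hdx
    · rw [map_zero, add_zero, ← h]
      exact f.totMap_tot hx
  · rintro n z hz hdz ⟨w, hw, hzw⟩
    obtain ⟨x, hx, rfl⟩ := mem_totGr.1 hz
    change X.totD _ = 0 at hdz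
    rw [totD_tot, ← tot_zero (X := X) (n := n + 1)] at hdz
    obtain ⟨z, hz, h⟩ := inj n x hx (tot_injective _ _ hdz)
      ⟨w, hw, (f.totMap_tot hx).symm.trans hzw⟩
    refine ⟨X.tot z hz, tot_mem hz, ?_⟩
    change _ = X.totD _
    rw [totD_tot]
    exact tot_congr _ _ (by ring) h

end HomTo

theorem toDGLie_isAbelian (X : DGLiePieces K)
    (h : ∀ (m n : ℤ) (x y : X.E), x ∈ X.P m → y ∈ X.P n → X.br m n x y = 0) :
    X.toDGLie.IsAbelian := by
  suffices H : ∀ z w : X.TotCarrier, X.totBracket z w = 0 from H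
  intro z w
  induction z using tot_induction with
  | h m x hx =>
    induction w using tot_induction with
    | h n y hy =>
      rw [totBracket_tot, ← tot_zero (X := X) (n := m + n)]
      exact tot_congr _ _ rfl (h m n x y hx hy)
    | hadd a b ha hb => rw [map_add, ha, hb, add_zero]
  | hadd a b ha hb => rw [map_add, LinearMap.add_apply, ha, hb, add_zero]

end DGLiePieces

/-! ### Adjoining an odd variable -/

section Sign

variable {K : Type u} [Field K]

theorem neg_one_zpow_eq_or (n : ℤ) : (-1 : K) ^ n = 1 ∨ (-1 : K) ^ n = -1 := by
  rcases Int.even_or_odd n with h | h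
  · exact Or.inl h.neg_one_zpow
  · exact Or.inr h.neg_one_zpow

theorem neg_one_zpow_add (m n : ℤ) : (-1 : K) ^ (m + n) = (-1 : K) ^ m * (-1 : K) ^ n :=
  zpow_add₀ (neg_ne_zero.2 one_ne_zero) m n

theorem neg_one_zpow_sub (m n : ℤ) : (-1 : K) ^ (m - n) = (-1 : K) ^ m * (-1 : K) ^ n := by
  rw [zpow_sub₀ (neg_ne_zero.2 one_ne_zero)]
  rcases neg_one_zpow_eq_or (K := K) n with h | h <;> rw [h]
  · rw [div_one, mul_one]
  · rw [div_neg, div_one, mul_neg, mul_one]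

theorem neg_one_zpow_mul_odd (m : ℤ) {e : ℤ} (he : Odd e) :
    (-1 : K) ^ (m * e) = (-1 : K) ^ m := by
  rw [mul_comm, zpow_mul, he.neg_one_zpow]

end Sign

namespace GradedLiePieces

variable {K : Type u} [Field K]

/-- The graded Lie algebra `X ⊗ K[η]`, for a variable `η` of odd degree `e` (so `η² = 0`). The pair
`(x, y)` stands for `x + η y`. -/
abbrev adjoin (X : GradedLiePieces K) (e : ℤ) (he : Odd e) : GradedLiePieces K where
  E := X.E × X.E
  P n := (X.P n).prod (X.P (n - e))
  br m n := LinearMap.mk₂ K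
    (fun p q => (X.br m n p.1 q.1, X.br (m - e) n p.2 q.1 + (-1 : K) ^ m • X.br m (n - e) p.1 q.2))
    (fun _ _ _ => Prod.ext (by simp) (by simp; abel))
    (fun _ _ _ => Prod.ext (by simp) (by simp [smul_comm _ ((-1 : K) ^ m)]))
    (fun _ _ _ => Prod.ext (by simp) (by simp; abel))
    (fun _ _ _ => Prod.ext (by simp) (by simp [smul_comm _ ((-1 : K) ^ m)]))
  br_mem := by
    rintro i j ⟨x, y⟩ ⟨x', y'⟩ ⟨hx, hy⟩ ⟨hx', hy'⟩
    refine ⟨X.br_mem hx hx', add_mem ?_ (Submodule.smul_mem _ _ ?_)⟩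
    · have := X.br_mem hy hx'
      rwa [show i - e + j = i + j - e by ring] at this
    · have := X.br_mem hx hy'
      rwa [show i + (j - e) = i + j - e by ring] at this
  skew := by
    rintro i j ⟨x, y⟩ ⟨x', y'⟩ ⟨hx, hy⟩ ⟨hx', hy'⟩
    refine Prod.ext (X.skew hx hx') ?_
    change X.br (i - e) j y x' + (-1 : K) ^ i • X.br i (j - e) x y' =
      -((-1 : K) ^ (i * j) • (X.br (j - e) i y' x + (-1 : K) ^ j • X.br j (i - e) x' y))
    rw [X.skew hy hx', X.skew hx hy', mul_sub, sub_mul, neg_one_zpow_sub, neg_one_zpow_sub,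
      mul_comm e j, neg_one_zpow_mul_odd _ he, neg_one_zpow_mul_odd _ he]
    rcases neg_one_zpow_eq_or (K := K) i with h | h <;>
    rcases neg_one_zpow_eq_or (K := K) j with h' | h' <;>
    rw [h, h'] <;> module
  jacobi := by
    rintro i j k ⟨x, y⟩ ⟨x', y'⟩ ⟨x'', y''⟩ ⟨hx, hy⟩ ⟨hx', hy'⟩ ⟨hx'', hy''⟩
    refine Prod.ext (X.jacobi hx hx' hx'') ?_
    have h1 := X.jacobi hy hx' hx''
    have h2 := X.jacobi hx hy' hx''
    have h3 := X.jacobi hx hx' hy''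
    rw [show i - e + j = i + j - e by ring, show i - e + k = i + k - e by ring, sub_mul,
      neg_one_zpow_sub, mul_comm e j, neg_one_zpow_mul_odd _ he] at h1
    rw [show j - e + k = j + k - e by ring, show i + (j - e) = i + j - e by ring, mul_sub,
      neg_one_zpow_sub, neg_one_zpow_mul_odd _ he] at h2
    rw [show j + (k - e) = j + k - e by ring, show i + (k - e) = i + k - e by ring] at h3
    change X.br (i - e) (j + k) y (X.br j k x' x'') + (-1 : K) ^ i • X.br i (j + k - e) x
        (X.br (j - e) k y' x'' + (-1 : K) ^ j • X.br j (k - e) x' y'') =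
      (X.br (i + j - e) k (X.br (i - e) j y x' + (-1 : K) ^ i • X.br i (j - e) x y') x'' +
        (-1 : K) ^ (i + j) • X.br (i + j) (k - e) (X.br i j x x') y'') +
      (-1 : K) ^ (i * j) • (X.br (j - e) (i + k) y' (X.br i k x x'') +
        (-1 : K) ^ j • X.br j (i + k - e) x'
          (X.br (i - e) k y x'' + (-1 : K) ^ i • X.br i (k - e) x y''))
    simp only [map_add, map_smul, LinearMap.add_apply, LinearMap.smul_apply] at h1 h2 h3 ⊢
    rw [h1, h2, h3, neg_one_zpow_add]
    rcases neg_one_zpow_eq_or (K := K) i with h | h <;>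
    rcases neg_one_zpow_eq_or (K := K) j with h' | h' <;>
    rw [h, h'] <;> module

end GradedLiePieces

/-! ### Polynomials with coefficients in a vector space -/

section Poly

variable {K : Type u} [Field K] {E E' : Type u} [AddCommGroup E] [Module K E]
  [AddCommGroup E'] [Module K E']

namespace VectorPoly

/-- The polynomials with all coefficients in `P`. A polynomial `∑ xₐ tᵃ` with coefficients in `E` is
encoded as the finitely supported function `a ↦ xₐ`. -/
def coeffsIn (P : Submodule K E) : Submodule K (ℕ →₀ E) where
  carrier := {f | ∀ a, f a ∈ P}
  zero_mem' _ := zero_mem P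
  add_mem' hf hg a := add_mem (hf a) (hg a)
  smul_mem' c _ hf a := Submodule.smul_mem _ c (hf a)

theorem single_mem {P : Submodule K E} (a : ℕ) {x : E} (hx : x ∈ P) :
    Finsupp.single a x ∈ coeffsIn P := by
  intro b
  rw [Finsupp.single_apply]
  split_ifs
  exacts [hx, zero_mem _]

theorem induction {P : Submodule K E} {p : ∀ f : ℕ →₀ E, f ∈ coeffsIn P → Prop}
    (single : ∀ (a : ℕ) (x : E) (hx : x ∈ P), p (Finsupp.single a x) (single_mem a hx))
    (add : ∀ f g hf hg, p f hf → p g hg → p (f + g) (add_mem hf hg))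
    {f : ℕ →₀ E} (hf : f ∈ coeffsIn P) : p f hf := by
  suffices h : ∃ h : f ∈ coeffsIn P, p f h from h.2
  rw [← Finsupp.sum_single f, Finsupp.sum]
  refine Finset.sum_induction _ (fun f => ∃ h : f ∈ coeffsIn P, p f h)
    (fun f g ⟨hf, hf'⟩ ⟨hg, hg'⟩ => ⟨_, add f g hf hg hf' hg'⟩) ?_
    fun a _ => ⟨_, single a _ (hf a)⟩
  rw [← Finsupp.single_zero 0]
  exact ⟨_, single 0 0 (zero_mem _)⟩

/-- The product of polynomials induced by a bilinear map on the coefficients. -/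
def conv (B : E →ₗ[K] E →ₗ[K] E) : (ℕ →₀ E) →ₗ[K] (ℕ →₀ E) →ₗ[K] (ℕ →₀ E) :=
  Finsupp.lsum K fun a => LinearMap.flip <| Finsupp.lsum K fun b => LinearMap.flip <|
    B.compr₂ (Finsupp.lsingle (a + b))

@[simp]
theorem conv_single (B : E →ₗ[K] E →ₗ[K] E) (a b : ℕ) (x y : E) :
    conv B (Finsupp.single a x) (Finsupp.single b y) = Finsupp.single (a + b) (B x y) := by
  simp [conv]

/-- The map induced by a linear map on the coefficients. -/
def map (φ : E →ₗ[K] E') : (ℕ →₀ E) →ₗ[K] (ℕ →₀ E') := Finsupp.mapRange.linearMap φ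

@[simp]
theorem map_single (φ : E →ₗ[K] E') (a : ℕ) (x : E) :
    map φ (Finsupp.single a x) = Finsupp.single a (φ x) := by
  simp [map]

theorem map_mem {φ : E →ₗ[K] E'} {P : Submodule K E} {P' : Submodule K E'}
    (h : ∀ x ∈ P, φ x ∈ P') {f : ℕ →₀ E} (hf : f ∈ coeffsIn P) : map φ f ∈ coeffsIn P' :=
  fun a => h _ (hf a)

/-- Evaluation at `t = 1`. -/
def ev : (ℕ →₀ E) →ₗ[K] E := Finsupp.lsum K fun _ => LinearMap.id

@[simp]
theorem ev_single (a : ℕ) (x : E) : ev (K := K) (Finsupp.single a x) = x := by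
  simp [ev]

/-- The derivative; at `a = 0` the truncated exponent `a - 1` is harmless, the coefficient being
zero. -/
def deriv : (ℕ →₀ E) →ₗ[K] (ℕ →₀ E) :=
  Finsupp.lsum K fun a => (a : K) • Finsupp.lsingle (a - 1)

@[simp]
theorem deriv_single (a : ℕ) (x : E) :
    deriv (K := K) (Finsupp.single a x) = Finsupp.single (a - 1) ((a : K) • x) := by
  simp [deriv]

/-- The primitive that vanishes at `t = 0`. -/
def integ : (ℕ →₀ E) →ₗ[K] (ℕ →₀ E) :=
  Finsupp.lsum K fun a => ((a : K) + 1)⁻¹ • Finsupp.lsingle (a + 1)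

@[simp]
theorem integ_single (a : ℕ) (x : E) :
    integ (K := K) (Finsupp.single a x) = Finsupp.single (a + 1) (((a : K) + 1)⁻¹ • x) := by
  simp [integ]

theorem ev_mem {P : Submodule K E} {f : ℕ →₀ E} (hf : f ∈ coeffsIn P) : ev (K := K) f ∈ P := by
  induction hf using induction with
  | single a x hx => simpa using hx
  | add f g _ _ hf hg => rw [map_add]; exact add_mem hf hg

theorem deriv_mem {P : Submodule K E} {f : ℕ →₀ E} (hf : f ∈ coeffsIn P) :
    deriv (K := K) f ∈ coeffsIn P := by
  induction hf using induction with
  | single a x hx => rw [deriv_single]; exact single_mem _ (Submodule.smul_mem _ _ hx)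
  | add f g _ _ hf hg => rw [map_add]; exact add_mem hf hg

theorem integ_mem {P : Submodule K E} {f : ℕ →₀ E} (hf : f ∈ coeffsIn P) :
    integ (K := K) f ∈ coeffsIn P := by
  induction hf using induction with
  | single a x hx => rw [integ_single]; exact single_mem _ (Submodule.smul_mem _ _ hx)
  | add f g _ _ hf hg => rw [map_add]; exact add_mem hf hg

theorem conv_mem {B : E →ₗ[K] E →ₗ[K] E} {P P' P'' : Submodule K E}
    (h : ∀ x ∈ P, ∀ y ∈ P', B x y ∈ P'') {f g : ℕ →₀ E} (hf : f ∈ coeffsIn P)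
    (hg : g ∈ coeffsIn P') : conv B f g ∈ coeffsIn P'' := by
  induction hf using induction with
  | single a x hx =>
    induction hg using induction with
    | single b y hy => rw [conv_single]; exact single_mem _ (h x hx y hy)
    | add f g _ _ hf hg => rw [map_add]; exact add_mem hf hg
  | add f g _ _ hf hg => rw [map_add]; exact add_mem hf hg

theorem ev_map (φ : E →ₗ[K] E') (f : ℕ →₀ E) : ev (K := K) (map φ f) = φ (ev (K := K) f) := by
  induction f using Finsupp.induction_linear with
  | zero => simp
  | add f g hf hg => simp only [map_add, hf, hg]
  | single a x => simp

theorem deriv_map (φ : E →ₗ[K] E') (f : ℕ →₀ E) :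
    deriv (K := K) (map φ f) = map φ (deriv (K := K) f) := by
  induction f using Finsupp.induction_linear with
  | zero => simp
  | add f g hf hg => simp only [map_add, hf, hg]
  | single a x => simp

theorem integ_map (φ : E →ₗ[K] E') (f : ℕ →₀ E) :
    integ (K := K) (map φ f) = map φ (integ (K := K) f) := by
  induction f using Finsupp.induction_linear with
  | zero => simp
  | add f g hf hg => simp only [map_add, hf, hg]
  | single a x => simp

theorem map_apply (φ : E →ₗ[K] E') (f : ℕ →₀ E) (a : ℕ) : map φ f a = φ (f a) := rfl

theorem ev_conv (B : E →ₗ[K] E →ₗ[K] E) (f g : ℕ →₀ E) :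
    ev (K := K) (conv B f g) = B (ev (K := K) f) (ev (K := K) g) := by
  induction f using Finsupp.induction_linear with
  | zero => simp
  | add f g hf hg => simp only [map_add, LinearMap.add_apply, hf, hg]
  | single a x =>
    induction g using Finsupp.induction_linear with
    | zero => simp
    | add f g hf hg => simp only [map_add, hf, hg]
    | single b y => simp

theorem conv_apply_zero (B : E →ₗ[K] E →ₗ[K] E) (f g : ℕ →₀ E) (hf : f 0 = 0) :
    conv B f g 0 = 0 := by
  suffices h : conv B f g 0 = B (f 0) (g 0) by rw [h, hf, map_zero, LinearMap.zero_apply]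
  clear hf
  induction f using Finsupp.induction_linear with
  | zero => simp
  | add f g hf hg => simp only [map_add, LinearMap.add_apply, Finsupp.add_apply, hf, hg]
  | single a x =>
    induction g using Finsupp.induction_linear with
    | zero => simp
    | add f g hf hg => simp only [map_add, Finsupp.add_apply, hf, hg]
    | single b y =>
      rw [conv_single]
      rcases Nat.eq_zero_or_pos a with rfl | ha
      · rcases Nat.eq_zero_or_pos b with rfl | hb
        · simp
        · simp [hb.ne']
      · simp [Finsupp.single_apply, ha.ne']

theorem deriv_conv (B : E →ₗ[K] E →ₗ[K] E) (f g : ℕ →₀ E) :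
    deriv (K := K) (conv B f g) =
      conv B (deriv (K := K) f) g + conv B f (deriv (K := K) g) := by
  induction f using Finsupp.induction_linear with
  | zero => simp
  | add f g hf hg => simp only [map_add, LinearMap.add_apply, hf, hg]; abel
  | single a x =>
    induction g using Finsupp.induction_linear with
    | zero => simp
    | add f g hf hg => simp only [map_add, hf, hg]; abel
    | single b y =>
      simp only [deriv_single, conv_single, map_smul, LinearMap.smul_apply]
      have h1 : Finsupp.single (a - 1 + b) ((a : K) • B x y) =
          Finsupp.single (a + b - 1) ((a : K) • B x y) := by
        rcases a with _ | a
        · simp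
        · congr 1; omega
      have h2 : Finsupp.single (a + (b - 1)) ((b : K) • B x y) =
          Finsupp.single (a + b - 1) ((b : K) • B x y) := by
        rcases b with _ | b
        · simp
        · congr 1
      rw [h1, h2, ← Finsupp.single_add, ← add_smul, Nat.cast_add]

theorem integ_apply_zero (f : ℕ →₀ E) : integ (K := K) f 0 = 0 := by
  induction f using Finsupp.induction_linear with
  | zero => simp
  | add f g hf hg => simp only [map_add, Finsupp.add_apply, hf, hg, add_zero]
  | single a x => simp

theorem deriv_integ [CharZero K] (f : ℕ →₀ E) : deriv (K := K) (integ (K := K) f) = f := by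
  induction f using Finsupp.induction_linear with
  | zero => simp
  | add f g hf hg => simp only [map_add, hf, hg]
  | single a x =>
    have : (a : K) + 1 ≠ 0 := by exact_mod_cast Nat.succ_ne_zero a
    simp [smul_smul, this]

theorem integ_deriv [CharZero K] (f : ℕ →₀ E) (hf : f 0 = 0) :
    integ (K := K) (deriv (K := K) f) = f := by
  suffices h : integ (K := K) (deriv (K := K) f) = f - Finsupp.single 0 (f 0) by
    rw [h, hf, Finsupp.single_zero, sub_zero]
  clear hf
  induction f using Finsupp.induction_linear with
  | zero => simp
  | add f g hf hg =>
    simp only [map_add, hf, hg, Finsupp.add_apply, Finsupp.single_add]; abel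
  | single a x =>
    rcases a with _ | a
    · simp
    · have : (a : K) + 1 ≠ 0 := by exact_mod_cast Nat.succ_ne_zero a
      simp [smul_smul, this]

end VectorPoly

end Poly

/-! ### Polynomial paths and homotopy fibres -/

namespace DGLiePieces

open VectorPoly

variable {K : Type u} [Field K]

/-- The DG-Lie algebra `X[t]`, with the differential of `X` on coefficients. -/
abbrev poly (X : DGLiePieces K) : DGLiePieces K where
  E := ℕ →₀ X.E
  P n := coeffsIn (X.P n)
  br m n := conv (X.br m n)
  br_mem hf hg := conv_mem (fun _ hx _ hy => X.br_mem hx hy) hf hg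
  skew := by
    intro i j f g hf hg
    induction hf using VectorPoly.induction with
    | single a x hx =>
      induction hg using VectorPoly.induction with
      | single b y hy =>
        rw [conv_single, conv_single, X.skew hx hy, Finsupp.single_neg, Finsupp.smul_single,
          add_comm a b]
      | add f g _ _ hf hg => simp only [map_add, LinearMap.add_apply, hf, hg, smul_add, neg_add]
    | add f g _ _ hf hg => simp only [map_add, LinearMap.add_apply, hf, hg, smul_add, neg_add]
  jacobi := by
    intro i j k f g h hf hg hh
    induction hf using VectorPoly.induction with
    | single a x hx =>
      induction hg using VectorPoly.induction with
      | single b y hy =>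
        induction hh using VectorPoly.induction with
        | single c z hz =>
          simp only [conv_single]
          rw [X.jacobi hx hy hz, Finsupp.single_add, Finsupp.smul_single, add_assoc a b c,
            add_left_comm b a c]
        | add f g _ _ hf hg => simp only [map_add, hf, hg, smul_add]; abel
      | add f g _ _ hf hg => simp only [map_add, LinearMap.add_apply, hf, hg, smul_add]; abel
    | add f g _ _ hf hg => simp only [map_add, LinearMap.add_apply, hf, hg, smul_add]; abel
  d n := map (X.d n)
  d_mem hf := map_mem (fun _ hx => X.d_mem hx) hf
  d_d := by
    intro i f hf
    ext a
    exact X.d_d (hf a)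
  leibniz := by
    intro i j f g hf hg
    induction hf using VectorPoly.induction with
    | single a x hx =>
      induction hg using VectorPoly.induction with
      | single b y hy =>
        simp only [conv_single, map_single]
        rw [X.leibniz hx hy, Finsupp.single_add, Finsupp.smul_single]
      | add f g _ _ hf hg => simp only [map_add, hf, hg, smul_add]; abel
    | add f g _ _ hf hg => simp only [map_add, LinearMap.add_apply, hf, hg, smul_add]; abel

/-- The DG-Lie algebra `X[t, dt]`. The pair `(f, g)` stands for `f + dt g`, so that
`d (f + dt g) = d f + dt (f' - d g)`. -/
abbrev path (X : DGLiePieces K) : DGLiePieces K where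
  toGradedLiePieces := X.poly.toGradedLiePieces.adjoin 1 odd_one
  d n := LinearMap.prod (X.poly.d n ∘ₗ LinearMap.fst K _ _)
    (VectorPoly.deriv ∘ₗ LinearMap.fst K _ _ - X.poly.d (n - 1) ∘ₗ LinearMap.snd K _ _)
  d_mem := by
    rintro n ⟨f, g⟩ ⟨hf, hg⟩
    refine ⟨X.poly.d_mem hf, ?_⟩
    have h1 := X.poly.d_mem hg
    rw [show n - 1 + 1 = n + 1 - 1 by ring] at h1
    refine sub_mem ?_ h1
    rw [show n + 1 - 1 = n by ring]
    exact deriv_mem hf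
  d_d := by
    rintro n ⟨f, g⟩ ⟨hf, hg⟩
    refine Prod.ext (X.poly.d_d hf) ?_
    change VectorPoly.deriv (X.poly.d n f) - X.poly.d (n + 1 - 1) (VectorPoly.deriv f - X.poly.d (n
        - 1) g) = 0
    have h1 := X.poly.d_d hg
    rw [show n - 1 + 1 = n + 1 - 1 by ring] at h1
    rw [map_sub, h1, sub_zero, show n + 1 - 1 = n by ring]
    exact sub_eq_zero.2 (deriv_map _ _)
  leibniz := by
    rintro i j ⟨f, g⟩ ⟨f', g'⟩ ⟨hf, hg⟩ ⟨hf', hg'⟩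
    refine Prod.ext (X.poly.leibniz hf hf') ?_
    change VectorPoly.deriv (X.poly.br i j f f') - X.poly.d (i + j - 1)
        (X.poly.br (i - 1) j g f' + (-1 : K) ^ i • X.poly.br i (j - 1) f g') =
      (X.poly.br (i + 1 - 1) j (VectorPoly.deriv f - X.poly.d (i - 1) g) f' +
        (-1 : K) ^ (i + 1) • X.poly.br (i + 1) (j - 1) (X.poly.d i f) g') +
      (-1 : K) ^ i • (X.poly.br (i - 1) (j + 1) g (X.poly.d j f') +
        (-1 : K) ^ i • X.poly.br i (j + 1 - 1) f (VectorPoly.deriv f' - X.poly.d (j - 1) g'))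
    have h0 : VectorPoly.deriv (X.poly.br i j f f') = X.poly.br i j (VectorPoly.deriv f) f' +
      X.poly.br i j f (VectorPoly.deriv f') := deriv_conv _ _ _
    have h1 := X.poly.leibniz hg hf'
    have h2 := X.poly.leibniz hf hg'
    rw [show i - 1 + j = i + j - 1 by ring, sub_add_cancel, neg_one_zpow_sub, zpow_one] at h1
    rw [show i + (j - 1) = i + j - 1 by ring, sub_add_cancel] at h2
    rw [h0, map_add, map_smul, h1, h2, add_sub_cancel_right, add_sub_cancel_right,
      neg_one_zpow_add, zpow_one, map_sub, map_sub, LinearMap.sub_apply]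
    rcases neg_one_zpow_eq_or (K := K) i with h | h <;> rw [h] <;> module

/-- A family of subspaces of the components, closed under bracket and differential. -/
abbrev restrict (X : DGLiePieces K) (P' : ℤ → Submodule K X.E) (hle : ∀ n, P' n ≤ X.P n)
    (hbr : ∀ {m n x y}, x ∈ P' m → y ∈ P' n → X.br m n x y ∈ P' (m + n))
    (hd : ∀ {n x}, x ∈ P' n → X.d n x ∈ P' (n + 1)) : DGLiePieces K where
  E := X.E
  P := P'
  br := X.br
  br_mem := hbr
  skew hx hy := X.skew (hle _ hx) (hle _ hy)
  jacobi hx hy hz := X.jacobi (hle _ hx) (hle _ hy) (hle _ hz)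
  d := X.d
  d_mem := hd
  d_d hx := X.d_d (hle _ hx)
  leibniz hx hy := X.leibniz (hle _ hx) (hle _ hy)

/-- A DG-Lie subalgebra, given by its homogeneous components. -/
structure Sub (X : DGLiePieces K) where
  N : ℤ → Submodule K X.E
  le : ∀ n, N n ≤ X.P n
  br_mem : ∀ {m n x y}, x ∈ N m → y ∈ N n → X.br m n x y ∈ N (m + n)
  d_mem : ∀ {n x}, x ∈ N n → X.d n x ∈ N (n + 1)

/-- The homotopy fibre of `N ⊆ X`: the polynomial paths `f + dt g` with `f(0) = 0` and `f(1) ∈ N`.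
-/
abbrev fiber (X : DGLiePieces K) (N : X.Sub) : DGLiePieces K :=
  X.path.restrict
    (fun n => X.path.P n ⊓ (LinearMap.ker (Finsupp.lapply 0) ⊓ (N.N n).comap ev).comap
      (LinearMap.fst K (ℕ →₀ X.E) (ℕ →₀ X.E)))
    (fun _ => inf_le_left)
    (fun {m n x y} hx hy => ⟨X.path.br_mem hx.1 hy.1, conv_apply_zero _ _ _ hx.2.1, by
      change ev (conv (X.br m n) x.1 y.1) ∈ N.N (m + n)
      rw [ev_conv]
      exact N.br_mem hx.2.2 hy.2.2⟩)
    (fun {n x} hx => ⟨X.path.d_mem hx.1, by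
      have h0 : x.1 0 = 0 := hx.2.1
      change X.d n (x.1 0) = 0
      rw [h0, map_zero], by
      change ev (map (X.d n) x.1) ∈ N.N (n + 1)
      rw [ev_map]
      exact N.d_mem hx.2.2⟩)

variable {X Y : DGLiePieces K} {N : X.Sub} {M : Y.Sub}

theorem mem_fiber {n : ℤ} {f g : ℕ →₀ X.E} :
    ((f, g) : (ℕ →₀ X.E) × (ℕ →₀ X.E)) ∈ (X.fiber N).P n ↔
      f ∈ coeffsIn (X.P n) ∧ g ∈ coeffsIn (X.P (n - 1)) ∧ f 0 = 0 ∧ ev (K := K) f ∈ N.N n :=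
  ⟨fun h => ⟨h.1.1, h.1.2, h.2.1, h.2.2⟩, fun h => ⟨⟨h.1, h.2.1⟩, h.2.2.1, h.2.2.2⟩⟩

theorem fiber_d (n : ℤ) (f g : ℕ →₀ X.E) :
    (X.fiber N).d n (f, g) =
      (VectorPoly.map (X.d n) f, VectorPoly.deriv (K := K) f - VectorPoly.map (X.d (n - 1)) g) :=
  rfl

/-- The integral `∫₀¹ g dt`. -/
def integral : (ℕ →₀ X.E) →ₗ[K] X.E := ev ∘ₗ integ

theorem integral_mem {P : Submodule K X.E} {g : ℕ →₀ X.E} (hg : g ∈ coeffsIn P) :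
    integral g ∈ P := ev_mem (integ_mem hg)

theorem integral_map (φ : X.E →ₗ[K] Y.E) (g : ℕ →₀ X.E) :
    integral (VectorPoly.map φ g) = φ (integral g) := by
  simp only [integral, LinearMap.comp_apply, integ_map, ev_map]

theorem integral_single_zero (x : X.E) : integral (Finsupp.single 0 x) = x := by
  simp [integral]

theorem integral_deriv [CharZero K] {f : ℕ →₀ X.E} (hf : f 0 = 0) :
    integral (VectorPoly.deriv (K := K) f) = ev (K := K) f := by
  simp only [integral, LinearMap.comp_apply, integ_deriv f hf]

/-- A cocycle `f + dt g` of the fibre is a boundary if `∫₀¹ g` is a boundary modulo `N`. -/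
theorem fiber_exact [CharZero K] {n : ℤ} {u : (X.fiber N).E} (hu : u ∈ (X.fiber N).P n)
    (hd : (X.fiber N).d n u = 0) {ν ρ : X.E} (hν : ν ∈ N.N (n - 1))
    (hρ : ρ ∈ X.P (n - 1 - 1)) (h : integral u.2 = ν + X.d (n - 1 - 1) ρ) :
    ∃ z ∈ (X.fiber N).P (n - 1), u = (X.fiber N).d (n - 1) z := by
  obtain ⟨f, g⟩ := u
  obtain ⟨hf, hg, hf0, hf1⟩ := mem_fiber.1 hu
  have hdρ : X.d (n - 1 - 1) ρ ∈ X.P (n - 1) := by simpa using X.d_mem hρ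
  have hddρ : X.d (n - 1) (X.d (n - 1 - 1) ρ) = 0 := by
    have := X.d_d hρ
    rwa [sub_add_cancel] at this
  have h2 : VectorPoly.map (X.d (n - 1)) g = VectorPoly.deriv (K := K) f :=
    (sub_eq_zero.1 (congrArg Prod.snd hd)).symm
  -- The path `∫₀ᵗ g - t dρ - dt ρ` takes the value `ν` at `t = 1`, and `d ∫₀ᵗ g = ∫₀ᵗ f' = f`.
  refine ⟨(integ (K := K) g - Finsupp.single 1 (X.d (n - 1 - 1) ρ), - Finsupp.single 0 ρ),
    mem_fiber.2 ⟨sub_mem (integ_mem hg) (single_mem _ hdρ), neg_mem (single_mem _ hρ), ?_, ?_⟩, ?_⟩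
  · rw [Finsupp.sub_apply, integ_apply_zero]
    simp
  · rw [map_sub, ev_single, show ev (K := K) (integ (K := K) g) = _ from h]
    simpa using hν
  · rw [fiber_d]
    refine Prod.ext ?_ ?_
    · simp only
      rw [map_sub, map_single, hddρ, Finsupp.single_zero, sub_zero, ← integ_map, h2,
        integ_deriv f hf0]
    · simp only
      rw [map_sub, deriv_integ, VectorPoly.deriv_single, map_neg, map_single]
      simp

/-- An element `γ` that is a cocycle modulo `N` lifts to the cocycle `t dγ + dt γ` of the fibre. -/
theorem fiber_section {n : ℤ} {γ : X.E} (hγ : γ ∈ X.P (n - 1)) (hd : X.d (n - 1) γ ∈ N.N n) :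
    (Finsupp.single 1 (X.d (n - 1) γ), Finsupp.single 0 γ) ∈ (X.fiber N).P n ∧
      (X.fiber N).d n (Finsupp.single 1 (X.d (n - 1) γ), Finsupp.single 0 γ) = 0 := by
  refine ⟨mem_fiber.2 ⟨single_mem _ (N.le _ hd), single_mem _ hγ, by simp, by simpa using hd⟩, ?_⟩
  have hdd : X.d n (X.d (n - 1) γ) = 0 := by
    have := X.d_d hγ
    rwa [sub_add_cancel] at this
  rw [fiber_d]
  refine Prod.ext ?_ ?_
  · simp [hdd]
  · simp

theorem d_integral [CharZero K] {n : ℤ} {f g : ℕ →₀ X.E}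
    (hfg : ((f, g) : (ℕ →₀ X.E) × (ℕ →₀ X.E)) ∈ (X.fiber N).P n)
    (hd : (X.fiber N).d n (f, g) = 0) : X.d (n - 1) (integral g) = ev (K := K) f := by
  have h2 : VectorPoly.deriv (K := K) f = VectorPoly.map (X.d (n - 1)) g :=
    (sub_eq_zero.1 (congrArg Prod.snd hd))
  rw [← integral_map, ← h2, integral_deriv (mem_fiber.1 hfg).2.2.1]

/-- The integral of the `dt`-component of the boundary of `h + dt k`. -/
theorem integral_fiber_d [CharZero K] {n : ℤ} {h k g : ℕ →₀ X.E} (h0 : h 0 = 0)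
    (hg : g = VectorPoly.deriv (K := K) h - VectorPoly.map (X.d n) k) :
    integral g = ev (K := K) h - X.d n (integral k) := by
  rw [hg, map_sub, integral_deriv h0, integral_map]

namespace Hom

theorem map_poly_br (φ : Hom X Y) {m n : ℤ} {f g : ℕ →₀ X.E} (hf : f ∈ coeffsIn (X.P m))
    (hg : g ∈ coeffsIn (X.P n)) : VectorPoly.map φ.φ (conv (X.br m n) f g) =
      conv (Y.br m n) (VectorPoly.map φ.φ f) (VectorPoly.map φ.φ g) := by
  induction hf using VectorPoly.induction with
  | single a x hx =>
    induction hg using VectorPoly.induction with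
    | single b y hy => simp only [conv_single, map_single, φ.map_br hx hy]
    | add f g _ _ hf hg => simp only [map_add, hf, hg]
  | add f g _ _ hf hg => simp only [map_add, LinearMap.add_apply, hf, hg]

theorem map_poly_d (φ : Hom X Y) {n : ℤ} {f : ℕ →₀ X.E} (hf : f ∈ coeffsIn (X.P n)) :
    VectorPoly.map φ.φ (VectorPoly.map (X.d n) f) =
      VectorPoly.map (Y.d n) (VectorPoly.map φ.φ f) := by
  ext a
  exact φ.map_d (hf a)

variable (N M)

/-- The morphism of homotopy fibres induced by a morphism of pairs. -/
def fiberMap (φ : Hom X Y) (h : ∀ n, ∀ x ∈ N.N n, φ.φ x ∈ M.N n) :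
    Hom (X.fiber N) (Y.fiber M) where
  φ := (VectorPoly.map φ.φ).prodMap (VectorPoly.map φ.φ)
  map_mem := by
    rintro n ⟨f, g⟩ hfg
    obtain ⟨hf, hg, hf0, hf1⟩ := mem_fiber.1 hfg
    refine mem_fiber.2 ⟨VectorPoly.map_mem (fun _ => φ.map_mem) hf,
        VectorPoly.map_mem (fun _ => φ.map_mem) hg, ?_, ?_⟩
    · change VectorPoly.map φ.φ f 0 = 0
      rw [map_apply, hf0, map_zero]
    · change ev (VectorPoly.map φ.φ f) ∈ M.N n
      rw [ev_map]; exact h _ _ hf1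
  map_d := by
    rintro n ⟨f, g⟩ hfg
    obtain ⟨hf, hg, hf0, hf1⟩ := mem_fiber.1 hfg
    refine Prod.ext (φ.map_poly_d hf) ?_
    change VectorPoly.map φ.φ (VectorPoly.deriv f - VectorPoly.map (X.d (n - 1)) g) =
      VectorPoly.deriv (VectorPoly.map φ.φ f) - VectorPoly.map (Y.d (n - 1)) (VectorPoly.map φ.φ g)
    rw [map_sub, φ.map_poly_d hg, deriv_map]
  map_br := by
    rintro m n ⟨f, g⟩ ⟨f', g'⟩ hfg hfg'
    obtain ⟨hf, hg, -, -⟩ := mem_fiber.1 hfg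
    obtain ⟨hf', hg', -, -⟩ := mem_fiber.1 hfg'
    refine Prod.ext (φ.map_poly_br hf hf') ?_
    change VectorPoly.map φ.φ (conv (X.br (m - 1) n) g f' +
        (-1 : K) ^ m • conv (X.br m (n - 1)) f g') =
      conv (Y.br (m - 1) n) (VectorPoly.map φ.φ g) (VectorPoly.map φ.φ f') +
        (-1 : K) ^ m • conv (Y.br m (n - 1)) (VectorPoly.map φ.φ f) (VectorPoly.map φ.φ g')
    rw [map_add, map_smul, φ.map_poly_br hg hf', φ.map_poly_br hf hg']

/-- A morphism of pairs inducing an isomorphism `X / N ≅ Y / M` induces a quasi-isomorphism of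
homotopy fibres. -/
theorem fiberMap_isQuasiIso [CharZero K] (φ : Hom X Y) (h : ∀ n, ∀ x ∈ N.N n, φ.φ x ∈ M.N n)
    (surj : ∀ n, ∀ y ∈ Y.P n, ∃ x ∈ X.P n, y - φ.φ x ∈ M.N n)
    (inj : ∀ n, ∀ x ∈ X.P n, φ.φ x ∈ M.N n → x ∈ N.N n) :
    (φ.fiberMap N M h).toDGLie.IsQuasiIso := by
  apply Hom.toDGLie_isQuasiIso
  · rintro n ⟨f, g⟩ hfg hd
    obtain ⟨hf, hg, hf0, hf1⟩ := mem_fiber.1 hfg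
    obtain ⟨γ, hγ, hμ⟩ := surj (n - 1) (integral g) (integral_mem hg)
    -- Write `∫₀¹ g = φ γ + μ` with `μ ∈ M`; the class of `f + dt g` is the image of the class of
    -- `t dγ + dt γ`, because the integral of the difference lies in `M`.
    have hdγ : X.d (n - 1) γ ∈ N.N n := by
      have hm : X.d (n - 1) γ ∈ X.P n := by simpa using X.d_mem hγ
      have hm' := M.d_mem hμ
      rw [map_sub, d_integral hfg hd, sub_add_cancel] at hm'
      refine inj n _ hm ?_
      rw [φ.map_d hγ]
      simpa using sub_mem hf1 hm'
    obtain ⟨hs, hds⟩ := fiber_section hγ hdγ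
    have hs' := (φ.fiberMap N M h).map_mem hs
    have hds' := (φ.fiberMap N M h).map_d hs
    rw [hds, map_zero] at hds'
    have hdu : (Y.fiber M).d n ((φ.fiberMap N M h).φ
        (Finsupp.single 1 (X.d (n - 1) γ), Finsupp.single 0 γ) - (f, g)) = 0 := by
      rw [map_sub, hd, ← hds', sub_zero]
    have hint : integral (VectorPoly.map φ.φ (Finsupp.single 0 γ) - g) =
        (φ.φ γ - integral g) + Y.d (n - 1 - 1) 0 := by
      rw [map_sub, map_single, integral_single_zero, map_zero, add_zero]
    obtain ⟨z, hz, e⟩ := fiber_exact (sub_mem hs' hfg) hdu (by simpa using neg_mem hμ)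
      (zero_mem _) hint
    exact ⟨_, hs, hds, z, hz, sub_eq_iff_eq_add'.1 e⟩
  · rintro n ⟨f, g⟩ hfg hd ⟨⟨p, q⟩, hpq, e⟩
    obtain ⟨hf, hg, hf0, hf1⟩ := mem_fiber.1 hfg
    obtain ⟨hp, hq, hp0, hp1⟩ := mem_fiber.1 hpq
    have e2 : VectorPoly.map φ.φ g =
      VectorPoly.deriv (K := K) p - VectorPoly.map (Y.d (n - 1 - 1)) q := congrArg Prod.snd e
    have e3 := integral_fiber_d hp0 e2
    rw [integral_map] at e3
    -- Write `∫₀¹ q = φ κ + μ` with `μ ∈ M`; then `φ (∫₀¹ g + d κ) = p(1) - d μ` lies in `M`.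
    obtain ⟨κ, hκ, hμ⟩ := surj (n - 1 - 1) (integral q) (integral_mem hq)
    have hν : integral g + X.d (n - 1 - 1) κ ∈ N.N (n - 1) := by
      refine inj _ _ (add_mem (integral_mem hg) (by simpa using X.d_mem hκ)) ?_
      have hm := M.d_mem hμ
      rw [sub_add_cancel] at hm
      rw [map_add, e3, φ.map_d hκ]
      have := sub_mem hp1 hm
      rw [map_sub] at this
      convert this using 1
      abel
    exact fiber_exact hfg hd hν (neg_mem hκ) (by rw [map_neg]; abel)

end Hom

section Abelian

variable (X) in
/-- The subspaces `C n`, with zero bracket and zero differential. -/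
abbrev abelianPieces (C : ℤ → Submodule K X.E) : DGLiePieces K where
  E := X.E
  P := C
  br _ _ := 0
  br_mem _ _ := zero_mem _
  skew _ _ := by simp
  jacobi _ _ _ := by simp
  d _ := 0
  d_mem _ := zero_mem _
  d_d _ := rfl
  leibniz _ _ := by simp

/-- The morphism `α ↦ dt α`, for cocycles `α` placed in the degree of `dt α`. -/
def abelianToFiber (C : ℤ → Submodule K X.E)
    (hC : ∀ n, ∀ x ∈ C n, x ∈ X.P (n - 1) ∧ X.d (n - 1) x = 0) :
    Hom (X.abelianPieces C) (X.fiber N) where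
  φ := LinearMap.prod 0 (Finsupp.lsingle 0)
  map_mem {n x} hx := mem_fiber.2
    ⟨zero_mem _, single_mem _ (hC n x hx).1, rfl, by simp⟩
  map_d {n x} hx := by
    change _ = (X.fiber N).d n (0, Finsupp.single 0 x)
    rw [fiber_d]
    refine Prod.ext ?_ ?_
    · simp
    · simp [(hC n x hx).2]
  map_br {m n x y} hx hy := by
    refine Prod.ext ?_ ?_
    · change (0 : ℕ →₀ X.E) = conv (X.br m n) 0 0
      simp
    · change Finsupp.single 0 (0 : X.E) = conv (X.br (m - 1) n) (Finsupp.single 0 x) 0 +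
        (-1 : K) ^ m • conv (X.br m (n - 1)) 0 (Finsupp.single 0 y)
      simp

/-- If each cocycle of `X / N` lifts, up to a boundary, to a cocycle of `X`, then the homotopy
fibre of `N ⊆ X` is quasi-isomorphic to an abelian DG-Lie algebra. -/
theorem exists_abelian_quasiIso_fiber [CharZero K] (N : X.Sub)
    (h : ∀ n, ∀ γ ∈ X.P n, X.d n γ ∈ N.N (n + 1) → ∃ α ∈ X.P n, X.d n α = 0 ∧
      ∃ ν ∈ N.N n, ∃ ρ ∈ X.P (n - 1), γ = α + (ν + X.d (n - 1) ρ)) :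
    ∃ A : DGLieAlgebra K, A.IsAbelian ∧
      ∃ f : DGLieAlgebra.Hom A (X.fiber N).toDGLie, f.IsQuasiIso := by
  -- `Z n` consists of the cocycles `α` such that `dt α` has degree `n`, and `B n` of those that are
  -- boundaries modulo `N`; a complement of `B n` in `Z n` represents each class exactly once.
  let Z : ℤ → Submodule K X.E := fun n => X.P (n - 1) ⊓ LinearMap.ker (X.d (n - 1))
  let B : ℤ → Submodule K X.E := fun n =>
    (N.N (n - 1) ⊔ (X.P (n - 1 - 1)).map (X.d (n - 1 - 1))) ⊓ Z n
  have hex := fun n : ℤ => Submodule.exists_isCompl (B n)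
  choose C hC using hex
  have hZ : ∀ n, ∀ x ∈ C n ⊓ Z n, x ∈ X.P (n - 1) ∧ X.d (n - 1) x = 0 := fun n x hx => hx.2
  refine ⟨(X.abelianPieces fun n => C n ⊓ Z n).toDGLie, toDGLie_isAbelian _ fun _ _ _ _ _ _ => rfl,
    (abelianToFiber (N := N) _ hZ).toDGLie, Hom.toDGLie_isQuasiIso _ ?_ ?_⟩
  · rintro n ⟨f, g⟩ hu hd
    obtain ⟨hf, hg, hf0, hf1⟩ := mem_fiber.1 hu
    have hdγ : X.d (n - 1) (integral g) ∈ N.N (n - 1 + 1) := by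
      rw [d_integral hu hd, sub_add_cancel]; exact hf1
    obtain ⟨α, hα, hdα, ν, hν, ρ, hρ, e⟩ := h (n - 1) _ (integral_mem hg) hdγ
    obtain ⟨k, hk, c, hc, hkc⟩ : ∃ k ∈ B n, ∃ c ∈ C n, k + c = α :=
      Submodule.mem_sup.1 ((hC n).sup_eq_top ▸ Submodule.mem_top)
    have hcZ : c ∈ C n ⊓ Z n := by
      refine ⟨hc, ?_⟩
      rw [← add_sub_cancel_left k c, hkc]
      exact sub_mem ⟨hα, hdα⟩ hk.2
    obtain ⟨ν', hν', _, ⟨ρ', hρ', rfl⟩, ek⟩ := Submodule.mem_sup.1 hk.1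
    have hs' := (abelianToFiber (N := N) _ hZ).map_mem hcZ
    have hds' := (abelianToFiber (N := N) _ hZ).map_d hcZ
    have hdu : (X.fiber N).d n ((abelianToFiber (N := N) _ hZ).φ c - (f, g)) = 0 := by
      rw [map_sub, hd, ← hds', sub_zero]
      exact map_zero _
    have hint : integral (Finsupp.single 0 c - g) =
        -(ν' + ν) + X.d (n - 1 - 1) (-(ρ' + ρ)) := by
      rw [map_sub, integral_single_zero, e, ← hkc, ← ek, map_neg, map_add]
      abel
    obtain ⟨z, hz, e'⟩ := fiber_exact (sub_mem hs' hu) hdu (neg_mem (add_mem hν' hν))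
      (neg_mem (add_mem hρ' hρ)) hint
    exact ⟨c, hcZ, rfl, z, hz, sub_eq_iff_eq_add'.1 e'⟩
  · rintro n x hx - ⟨⟨p, q⟩, hpq, e⟩
    obtain ⟨hp, hq, hp0, hp1⟩ := mem_fiber.1 hpq
    have e2 : Finsupp.single 0 x =
      VectorPoly.deriv (K := K) p - VectorPoly.map (X.d (n - 1 - 1)) q := congrArg Prod.snd e
    have e3 := integral_fiber_d hp0 e2
    rw [integral_single_zero] at e3
    have hxB : x ∈ B n := by
      refine ⟨?_, hx.2⟩
      rw [e3]
      exact sub_mem (Submodule.mem_sup_left hp1)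
        (Submodule.mem_sup_right ⟨_, integral_mem hq, rfl⟩)
    exact ⟨0, zero_mem _, Submodule.disjoint_def.1 (hC n).disjoint x hxB hx.1⟩

end Abelian

end DGLiePieces

/-! ### The cone of a DG-Lie algebra -/

namespace DGLieAlgebra

open VectorPoly

variable {K : Type u} [Field K] (L : DGLieAlgebra K)

/-- The underlying graded Lie algebra, given by its homogeneous components. -/
abbrev toGradedLiePieces : GradedLiePieces K where
  E := L.carrier
  P := L.gr
  br _ _ := L.bracket
  br_mem := L.bracket_mem
  skew := L.skew
  jacobi hx hy _ := L.jacobi _ hx hy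

/-- The cone `L ⊕ ε L` of `L`, with `ε` of degree `-1` and `d ε = 1`. The pair `(x, y)` stands for
`x + ε y`. -/
abbrev cone : DGLiePieces K where
  toGradedLiePieces := L.toGradedLiePieces.adjoin (-1) (by decide)
  d _ := LinearMap.prod (L.d ∘ₗ LinearMap.fst K _ _ + LinearMap.snd K _ _)
    (- L.d ∘ₗ LinearMap.snd K _ _)
  d_mem := by
    rintro n ⟨x, y⟩ ⟨hx, hy⟩
    change y ∈ L.gr (n - -1) at hy
    refine ⟨add_mem (L.d_mem hx) ?_, neg_mem ?_⟩
    · rwa [sub_neg_eq_add] at hy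
    · have := L.d_mem hy
      rwa [show n - -1 + 1 = n + 1 - -1 by ring] at this
  d_d := by
    rintro n ⟨x, y⟩ -
    refine Prod.ext ?_ ?_
    · change L.d (L.d x + y) + -L.d y = 0
      rw [map_add, L.d_d, zero_add, add_neg_cancel]
    · change -L.d (-L.d y) = 0
      rw [map_neg, L.d_d, neg_zero, neg_zero]
  leibniz := by
    rintro i j ⟨x, y⟩ ⟨x', y'⟩ ⟨hx, hy⟩ ⟨hx', hy'⟩
    change y ∈ L.gr (i - -1) at hy
    have h0 := L.leibniz x' hx
    have h1 := L.leibniz x' hy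
    have h2 := L.leibniz y' hx
    rw [neg_one_zpow_sub, zpow_neg_one, inv_neg_one] at h1
    refine Prod.ext ?_ ?_
    · change L.d (L.bracket x x') + (L.bracket y x' + (-1 : K) ^ i • L.bracket x y') =
        L.bracket (L.d x + y) x' + (-1 : K) ^ i • L.bracket x (L.d x' + y')
      rw [h0]
      simp only [map_add, LinearMap.add_apply, smul_add]
      abel
    · change -L.d (L.bracket y x' + (-1 : K) ^ i • L.bracket x y') =
        (L.bracket (-L.d y) x' + (-1 : K) ^ (i + 1) • L.bracket (L.d x + y) y') +
        (-1 : K) ^ i • (L.bracket y (L.d x' + y') + (-1 : K) ^ i • L.bracket x (-L.d y'))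
      rw [neg_one_zpow_add, zpow_one]
      simp only [map_add, map_smul, h1, h2, LinearMap.add_apply, map_neg, LinearMap.neg_apply]
      rcases neg_one_zpow_eq_or (K := K) i with h | h <;> rw [h] <;> module

/-- The subalgebra `L` of its cone. -/
abbrev coneBase : L.cone.Sub where
  N n := (L.gr n).prod ⊥
  le n := Submodule.prod_mono le_rfl bot_le
  br_mem := by
    rintro m n ⟨x, y⟩ ⟨x', y'⟩ ⟨hx, hy⟩ ⟨hx', hy'⟩
    refine ⟨L.bracket_mem hx hx', ?_⟩
    change y = 0 at hy
    change y' = 0 at hy'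
    subst hy; subst hy'
    change L.bracket 0 x' + (-1 : K) ^ m • L.bracket x 0 = 0
    simp
  d_mem := by
    rintro n ⟨x, y⟩ ⟨hx, hy⟩
    change y = 0 at hy
    subst hy
    refine ⟨?_, ?_⟩
    · change L.d x + 0 ∈ _
      rw [add_zero]; exact L.d_mem hx
    · change -L.d 0 = 0
      simp

/-- The evaluation `f + dt g ↦ f(1) ∈ L` on the homotopy fibre of `L ⊆ L ⊕ ε L`. -/
def coneFiberEval : DGLiePieces.HomTo (L.cone.fiber L.coneBase) L where
  φ := LinearMap.fst K _ _ ∘ₗ ev (K := K) ∘ₗ LinearMap.fst K _ _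
  map_mem := by
    rintro n ⟨f, g⟩ hfg
    exact (DGLiePieces.mem_fiber.1 hfg).2.2.2.1
  map_d := by
    rintro n ⟨f, g⟩ hfg
    have h := (DGLiePieces.mem_fiber.1 hfg).2.2.2.2
    change (ev (K := K) (VectorPoly.map (L.cone.d n) f)).1 = L.d (ev (K := K) f).1
    rw [ev_map]
    change L.d (ev (K := K) f).1 + (ev (K := K) f).2 = _
    rw [show (ev (K := K) f).2 = 0 from h, add_zero]
  map_br := by
    rintro m n ⟨f, g⟩ ⟨f', g'⟩ hfg hfg'
    change (ev (K := K) (conv (L.cone.br m n) f f')).1 = _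
    rw [ev_conv]
    rfl

/-- The homotopy fibre of the inclusion of `L` in its cone is quasi-isomorphic to `L`, the cone
being acyclic. -/
theorem coneFiberEval_isQuasiIso [CharZero K] : L.coneFiberEval.toDGLie.IsQuasiIso := by
  apply DGLiePieces.HomTo.toDGLie_isQuasiIso
  · intro n y hy hdy
    have hγ : ((0, y) : L.carrier × L.carrier) ∈ L.cone.P (n - 1) :=
      ⟨zero_mem _, by simpa using hy⟩
    have hdγ : L.cone.d (n - 1) (0, y) = (y, 0) := by
      refine Prod.ext ?_ ?_
      · change L.d 0 + y = y
        simp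
      · change -L.d y = 0
        simp [hdy]
    obtain ⟨hs, hds⟩ := DGLiePieces.fiber_section (N := L.coneBase) hγ
      (by rw [hdγ]; exact ⟨hy, zero_mem _⟩)
    refine ⟨_, hs, hds, ?_⟩
    change (ev (K := K) (Finsupp.single 1 (L.cone.d (n - 1) (0, y)))).1 = y
    rw [ev_single, hdγ]
  · rintro n ⟨f, g⟩ hfg hd ⟨z, hz, e⟩
    obtain ⟨hf, hg, hf0, hf1⟩ := DGLiePieces.mem_fiber.1 hfg
    have hG := DGLiePieces.d_integral hfg hd
    have hmem := DGLiePieces.integral_mem hg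
    change (ev (K := K) f).1 = L.d z at e
    have e1 : L.d (DGLiePieces.integral (X := L.cone) g).1 +
        (DGLiePieces.integral (X := L.cone) g).2 = L.d z := (congrArg Prod.fst hG).trans e
    have ha : (DGLiePieces.integral (X := L.cone) g).1 ∈ L.gr (n - 1) := hmem.1
    -- With `∫₀¹ g = a + ε b`, the equation `d a + b = d z` reads `∫₀¹ g = z + d (ε (a - z))`.
    refine DGLiePieces.fiber_exact hfg hd (ν := (z, 0))
      (ρ := (0, (DGLiePieces.integral (X := L.cone) g).1 - z)) ⟨hz, zero_mem _⟩
      ⟨zero_mem _, ?_⟩ (Prod.ext ?_ ?_)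
    · change _ ∈ L.gr (n - 1 - 1 - -1)
      rw [sub_neg_eq_add, sub_add_cancel]
      exact sub_mem ha hz
    · change (DGLiePieces.integral (X := L.cone) g).1 =
        z + (L.d 0 + ((DGLiePieces.integral (X := L.cone) g).1 - z))
      rw [map_zero, zero_add, add_sub_cancel]
    · change (DGLiePieces.integral (X := L.cone) g).2 =
        0 + -L.d ((DGLiePieces.integral (X := L.cone) g).1 - z)
      rw [map_sub, ← e1]
      abel

end DGLieAlgebra

/-! ### Induction on the symmetric algebra -/

namespace GradedSym

open scoped TensorProduct

variable {K : Type u} [Field K] {V : Type u} [AddCommGroup V] [Module K V]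

section Basic

variable {𝒱 : ℤ → Submodule K V}

theorem one_mem_symGr : (1 : Sym 𝒱) ∈ symGr 𝒱 0 :=
  Submodule.subset_span ⟨[], by simp, by simp, by simp⟩

theorem ι_mul_mem_symGr {i m : ℤ} {v : V} (hv : v ∈ 𝒱 i) {w : Sym 𝒱} (hw : w ∈ symGr 𝒱 m) :
    ι 𝒱 v * w ∈ symGr 𝒱 (i + m) := by
  induction hw using Submodule.span_induction with
  | mem w hw =>
    obtain ⟨l, hl, hs, rfl⟩ := hw
    refine Submodule.subset_span ⟨(i, v) :: l, ?_, by simp [hs], by simp⟩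
    intro p hp
    rcases List.mem_cons.1 hp with rfl | hp
    exacts [hv, hl p hp]
  | zero => rw [mul_zero]; exact zero_mem _
  | add x y _ _ hx hy => rw [mul_add]; exact add_mem hx hy
  | smul c x _ hx => rw [mul_smul_comm]; exact Submodule.smul_mem _ c hx

theorem ι_mem_symGr {i : ℤ} {v : V} (hv : v ∈ 𝒱 i) : ι 𝒱 v ∈ symGr 𝒱 i := by
  have := ι_mul_mem_symGr hv (one_mem_symGr (𝒱 := 𝒱))
  rwa [mul_one, add_zero] at this

theorem symGr_induction {p : ∀ (m : ℤ) (w : Sym 𝒱), w ∈ symGr 𝒱 m → Prop}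
    (one : p 0 1 one_mem_symGr) (zero : ∀ m, p m 0 (zero_mem _))
    (add : ∀ m w w' hw hw', p m w hw → p m w' hw' → p m (w + w') (add_mem hw hw'))
    (smul : ∀ m (c : K) w hw, p m w hw → p m (c • w) (Submodule.smul_mem _ c hw))
    (mul : ∀ i m v w (hv : v ∈ 𝒱 i) (hw : w ∈ symGr 𝒱 m), p m w hw →
      p (i + m) (ι 𝒱 v * w) (ι_mul_mem_symGr hv hw))
    {m : ℤ} {w : Sym 𝒱} (hw : w ∈ symGr 𝒱 m) : p m w hw := by
  have hl : ∀ l : List (ℤ × V), (∀ p ∈ l, p.2 ∈ 𝒱 p.1) → ∀ m, (l.map Prod.fst).sum = m →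
      ∃ h, p m (l.map fun p => ι 𝒱 p.2).prod h := by
    intro l
    induction l with
    | nil => rintro - m rfl; exact ⟨_, one⟩
    | cons a l ih =>
      rintro hl m rfl
      obtain ⟨h, h'⟩ := ih (fun p hp => hl p (List.mem_cons_of_mem _ hp)) _ rfl
      simp only [List.map_cons, List.prod_cons, List.sum_cons]
      exact ⟨ι_mul_mem_symGr (hl a List.mem_cons_self) h,
        mul _ _ _ _ (hl a List.mem_cons_self) h h'⟩
  suffices h : ∃ h, p m w h from h.2
  induction hw using Submodule.span_induction with
  | mem w hw =>
    obtain ⟨l, hl', hs, rfl⟩ := hw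
    exact hl l hl' m hs
  | zero => exact ⟨_, zero m⟩
  | add x y _ _ hx hy => exact ⟨_, add _ _ _ _ _ hx.2 hy.2⟩
  | smul c x _ hx => exact ⟨_, smul _ c _ _ hx.2⟩

theorem sym_induction [DirectSum.Decomposition 𝒱] {p : Sym 𝒱 → Prop} (one : p 1)
    (add : ∀ w w', p w → p w' → p (w + w')) (smul : ∀ (c : K) w, p w → p (c • w))
    (mul : ∀ i v w, v ∈ 𝒱 i → p w → p (ι 𝒱 v * w)) (w : Sym 𝒱) : p w := by
  have hmul : ∀ v w, p w → p (ι 𝒱 v * w) := by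
    intro v w hw
    induction v using DirectSum.Decomposition.inductionOn 𝒱 with
    | zero => rw [map_zero, ← zero_smul K 1, smul_mul_assoc, one_mul]; exact smul 0 _ hw
    | homogeneous v => exact mul _ _ _ v.2 hw
    | add v v' hv hv' => rw [map_add, add_mul]; exact add _ _ hv hv'
  have key : ∀ (z : TensorAlgebra K V) (w : Sym 𝒱), p w → p (mkAlgHom 𝒱 z * w) := by
    intro z
    induction z using TensorAlgebra.induction with
    | algebraMap r =>
      intro w hw
      rw [AlgHom.commutes, ← Algebra.smul_def]; exact smul r w hw
    | ι v => exact hmul v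
    | mul a b ha hb => intro w hw; rw [map_mul, mul_assoc]; exact ha _ (hb _ hw)
    | add a b ha hb => intro w hw; rw [map_add, add_mul]; exact add _ _ (ha _ hw) (hb _ hw)
  obtain ⟨z, rfl⟩ := RingQuot.mkAlgHom_surjective K (Rel 𝒱) w
  have := key z 1 one
  rwa [mul_one] at this

theorem iSup_symGr [DirectSum.Decomposition 𝒱] : ⨆ m, symGr 𝒱 m = ⊤ := by
  rw [eq_top_iff]
  intro w _
  induction w using sym_induction (𝒱 := 𝒱) with
  | one => exact Submodule.mem_iSup_of_mem 0 one_mem_symGr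
  | add w w' hw hw' => exact add_mem (hw trivial) (hw' trivial)
  | smul c w hw => exact Submodule.smul_mem _ c (hw trivial)
  | mul i v w hv hw =>
    refine Submodule.iSup_induction _ (motive := fun w => ι 𝒱 v * w ∈ ⨆ m, symGr 𝒱 m)
      (hw trivial) (fun m w hw => Submodule.mem_iSup_of_mem (i + m) (ι_mul_mem_symGr hv hw)) ?_ ?_
    · rw [mul_zero]; exact zero_mem _
    · intro x y hx hy; rw [mul_add]; exact add_mem hx hy

theorem linearMap_ext_symGr [DirectSum.Decomposition 𝒱] {W : Type*} [AddCommGroup W] [Module K W]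
    {f g : Sym 𝒱 →ₗ[K] W} (h : ∀ m, ∀ w ∈ symGr 𝒱 m, f w = g w) : f = g := by
  refine LinearMap.ext fun w => ?_
  have hw : w ∈ ⨆ m, symGr 𝒱 m := iSup_symGr (𝒱 := 𝒱) ▸ Submodule.mem_top
  refine Submodule.iSup_induction _ (motive := fun w => f w = g w) hw h ?_ ?_
  · rw [map_zero, map_zero]
  · intro x y hx hy; rw [map_add, map_add, hx, hy]

/-- Linear maps on `S V` that are homogeneous of degree `k`. -/
def HasDegree (𝒱 : ℤ → Submodule K V) {W : Type*} [AddCommGroup W] [Module K W]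
    (𝒲 : ℤ → Submodule K W) (k : ℤ) (q : Sym 𝒱 →ₗ[K] W) : Prop :=
  ∀ m : ℤ, ∀ w ∈ symGr 𝒱 m, q w ∈ 𝒲 (m + k)

end Basic

/-! ### Homogeneous operators on the symmetric algebra -/

section Operators

variable {𝒱 : ℤ → Submodule K V}

variable (𝒱) in
/-- The operator `v ⊙ ·` on `S V`. -/
def mulι : V →ₗ[K] Module.End K (Sym 𝒱) := LinearMap.mul K (Sym 𝒱) ∘ₗ ι 𝒱

@[simp]
theorem mulι_apply (v : V) (w : Sym 𝒱) : mulι 𝒱 v w = ι 𝒱 v * w := rfl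

theorem mulι_hasDegree {i : ℤ} {v : V} (hv : v ∈ 𝒱 i) :
    HasDegree 𝒱 (symGr 𝒱) i (mulι 𝒱 v) := fun m w hw => by
  rw [add_comm]; exact ι_mul_mem_symGr hv hw

theorem HasDegree.comp_mulι {W : Type*} [AddCommGroup W] [Module K W]
    {𝒲 : ℤ → Submodule K W} {k i : ℤ} {q : Sym 𝒱 →ₗ[K] W} (hq : HasDegree 𝒱 𝒲 k q) {v : V}
    (hv : v ∈ 𝒱 i) : HasDegree 𝒱 𝒲 (k + i) (q ∘ₗ mulι 𝒱 v) := fun m w hw => by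
  have := hq _ _ (ι_mul_mem_symGr hv hw)
  rwa [show i + m + k = m + (k + i) by ring] at this

/-- The graded commutator `αβ - (-1)^{mn} βα`, for operators viewed as having degrees `m` and `n`.
-/
def gradedComm {S : Type u} [AddCommGroup S] [Module K S] (m n : ℤ) :
    Module.End K S →ₗ[K] Module.End K S →ₗ[K] Module.End K S :=
  LinearMap.mul K (Module.End K S) - (-1 : K) ^ (m * n) • (LinearMap.mul K (Module.End K S)).flip

theorem gradedComm_apply {S : Type u} [AddCommGroup S] [Module K S] (m n : ℤ)
    (α β : Module.End K S) : gradedComm m n α β = α * β - (-1 : K) ^ (m * n) • (β * α) := rfl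

theorem gradedComm_hasDegree {m n : ℤ} {α β : Module.End K (Sym 𝒱)}
    (hα : HasDegree 𝒱 (symGr 𝒱) m α) (hβ : HasDegree 𝒱 (symGr 𝒱) n β) :
    HasDegree 𝒱 (symGr 𝒱) (m + n) (gradedComm m n α β) := by
  intro i w hw
  refine sub_mem ?_ (Submodule.smul_mem _ _ ?_)
  · have := hα _ _ (hβ _ _ hw)
    rwa [show i + n + m = i + (m + n) by ring] at this
  · have := hβ _ _ (hα _ _ hw)
    rwa [show i + m + n = i + (m + n) by ring] at this

theorem gradedComm_skew {S : Type u} [AddCommGroup S] [Module K S] (m n : ℤ)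
    (α β : Module.End K S) : gradedComm m n α β = -((-1 : K) ^ (m * n) • gradedComm n m β α) := by
  rw [gradedComm_apply, gradedComm_apply, mul_comm n m]
  rcases neg_one_zpow_eq_or (K := K) (m * n) with h | h <;> rw [h] <;> module

theorem gradedComm_jacobi {S : Type u} [AddCommGroup S] [Module K S] (i j k : ℤ)
    (α β γ : Module.End K S) : gradedComm i (j + k) α (gradedComm j k β γ) =
      gradedComm (i + j) k (gradedComm i j α β) γ + (-1 : K) ^ (i * j) • gradedComm j (i + k) β
          (gradedComm i k α γ) := by
  simp only [gradedComm_apply, mul_add, add_mul, neg_one_zpow_add, mul_sub, sub_mul, mul_smul_comm,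
    smul_mul_assoc, mul_assoc, mul_comm j i]
  rcases neg_one_zpow_eq_or (K := K) (i * j) with h | h <;>
  rcases neg_one_zpow_eq_or (K := K) (i * k) with h' | h' <;>
  rcases neg_one_zpow_eq_or (K := K) (j * k) with h'' | h'' <;>
  rw [h, h', h''] <;> module

variable [DirectSum.Decomposition 𝒱]

/-- An operator on `S V` is determined by its value at `1` and by its graded commutators with the
multiplications by elements of `V`. -/
theorem end_ext {α β : Module.End K (Sym 𝒱)} (k : ℤ) (h1 : α 1 = β 1)
    (h : ∀ i, ∀ v ∈ 𝒱 i, gradedComm k i α (mulι 𝒱 v) = gradedComm k i β (mulι 𝒱 v)) : α = β := by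
  refine LinearMap.ext fun w => ?_
  induction w using sym_induction (𝒱 := 𝒱) with
  | one => exact h1
  | add w w' hw hw' => rw [map_add, map_add, hw, hw']
  | smul c w hw => rw [map_smul, map_smul, hw]
  | mul i v w hv hw =>
    have := LinearMap.congr_fun (h i v hv) w
    simp only [gradedComm_apply, LinearMap.sub_apply, LinearMap.smul_apply, Module.End.mul_apply,
      mulι_apply, hw] at this
    exact sub_left_injective this

theorem sign_of_mem (n : ℤ) {m : ℤ} {w : Sym 𝒱} (hw : w ∈ symGr 𝒱 m) :
    sign 𝒱 n w = (-1 : K) ^ (n * m) • w := by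
  induction hw using symGr_induction with
  | one => simp
  | zero m => simp
  | add m w w' _ _ h h' => rw [map_add, h, h', smul_add]
  | smul m c w _ h => rw [map_smul, h, smul_comm]
  | mul i m v w hv _ h =>
    rw [map_mul, sign_ι, signV_of_mem n hv, h, map_smul, smul_mul_smul_comm, mul_add,
      neg_one_zpow_add]

theorem sign_comp (m n : ℤ) (w : Sym 𝒱) : sign 𝒱 m (sign 𝒱 n w) = sign 𝒱 (m + n) w := by
  refine LinearMap.congr_fun (f := (sign 𝒱 m).toLinearMap ∘ₗ (sign 𝒱 n).toLinearMap)
    (g := (sign 𝒱 (m + n)).toLinearMap) (linearMap_ext_symGr fun i w hw => ?_) w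
  simp only [LinearMap.comp_apply, AlgHom.toLinearMap_apply, sign_of_mem _ hw, map_smul,
    smul_smul, add_mul, neg_one_zpow_add]
  rw [mul_comm]

theorem HasDegree.sign_apply {k : ℤ} {α : Module.End K (Sym 𝒱)}
    (hα : HasDegree 𝒱 (symGr 𝒱) k α) (n : ℤ) (w : Sym 𝒱) :
    α (sign 𝒱 n w) = (-1 : K) ^ (n * k) • sign 𝒱 n (α w) := by
  refine LinearMap.congr_fun (f := α ∘ₗ (sign 𝒱 n).toLinearMap)
    (g := (-1 : K) ^ (n * k) • ((sign 𝒱 n).toLinearMap ∘ₗ α)) (linearMap_ext_symGr fun i w hw =>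
        ?_) w
  simp only [LinearMap.comp_apply, LinearMap.smul_apply, AlgHom.toLinearMap_apply,
    sign_of_mem _ hw, sign_of_mem _ (hα _ _ hw), map_smul, smul_smul, mul_add, neg_one_zpow_add]
  congr 1
  rcases neg_one_zpow_eq_or (K := K) (n * k) with h | h <;> rw [h] <;> ring

theorem mulι_sign {i : ℤ} {v : V} (hv : v ∈ 𝒱 i) (n : ℤ) (w : Sym 𝒱) :
    sign 𝒱 n (ι 𝒱 v * w) = (-1 : K) ^ (n * i) • (ι 𝒱 v * sign 𝒱 n w) := by
  rw [map_mul, sign_ι, signV_of_mem n hv, map_smul, smul_mul_assoc]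

end Operators

/-! ### Coderivations -/

section Coderivations

variable {𝒱 : ℤ → Submodule K V} [DirectSum.Decomposition 𝒱]

theorem coderOfCorestriction_one (q : Sym 𝒱 →ₗ[K] V) :
    coderOfCorestriction 𝒱 q 1 = ι 𝒱 (q 1) := by
  simp [coderOfCorestriction, comul_one]

theorem ι_apply_mul_ι {k i : ℤ} {q : Sym 𝒱 →ₗ[K] V} (hq : HasDegree 𝒱 𝒱 k q) {v : V}
    (hv : v ∈ 𝒱 i) (a : Sym 𝒱) :
    ι 𝒱 (q (sign 𝒱 i a)) * ι 𝒱 v = (-1 : K) ^ (k * i) • (ι 𝒱 v * ι 𝒱 (q a)) := by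
  refine LinearMap.congr_fun (f := LinearMap.mulRight K (ι 𝒱 v) ∘ₗ ι 𝒱 ∘ₗ q ∘ₗ
    (sign 𝒱 i).toLinearMap) (g := (-1 : K) ^ (k * i) • (mulι 𝒱 v ∘ₗ ι 𝒱 ∘ₗ q))
    (linearMap_ext_symGr fun m w hw => ?_) a
  simp only [LinearMap.comp_apply, LinearMap.smul_apply, AlgHom.toLinearMap_apply,
    sign_of_mem _ hw, map_smul, LinearMap.mulRight_apply, mulι_apply, ι_mul_ι (hq m w hw) hv,
    smul_smul, add_mul, neg_one_zpow_add, mul_comm i m]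
  rcases neg_one_zpow_eq_or (K := K) (m * i) with h | h <;> rw [h] <;> simp

theorem coderOfCorestriction_ι_mul {k i : ℤ} {q : Sym 𝒱 →ₗ[K] V} (hq : HasDegree 𝒱 𝒱 k q)
    {v : V} (hv : v ∈ 𝒱 i) (w : Sym 𝒱) :
    coderOfCorestriction 𝒱 q (ι 𝒱 v * w) = coderOfCorestriction 𝒱 (q ∘ₗ mulι 𝒱 v) w +
      (-1 : K) ^ (k * i) • (ι 𝒱 v * coderOfCorestriction 𝒱 q w) := by
  have h : LinearMap.mul' K (Sym 𝒱) ∘ₗ TensorProduct.map (ι 𝒱 ∘ₗ q) LinearMap.id ∘ₗ comulOp 𝒱 v =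
      LinearMap.mul' K (Sym 𝒱) ∘ₗ TensorProduct.map (ι 𝒱 ∘ₗ q ∘ₗ mulι 𝒱 v) LinearMap.id +
      (-1 : K) ^ (k * i) • (mulι 𝒱 v ∘ₗ LinearMap.mul' K (Sym 𝒱) ∘ₗ
        TensorProduct.map (ι 𝒱 ∘ₗ q) LinearMap.id) := by
    refine TensorProduct.ext' fun a b => ?_
    simp only [LinearMap.comp_apply, LinearMap.add_apply, LinearMap.smul_apply, comulOp_tmul hv,
      map_add, TensorProduct.map_tmul, LinearMap.mul'_apply, LinearMap.id_apply, mulι_apply]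
    rw [← mul_assoc, ι_apply_mul_ι hq hv, smul_mul_assoc, mul_assoc]
  simp only [coderOfCorestriction, LinearMap.comp_apply, comul_ι_mul]
  exact LinearMap.congr_fun h (comul 𝒱 w)

/-- The commutator of the coderivation with corestriction `q` with `v ⊙ ·` is the coderivation with
corestriction `q (v ⊙ ·)`. With `end_ext`, this reduces identities between coderivations to
identities between their corestrictions. -/
theorem gradedComm_coderOfCorestriction {k i : ℤ} {q : Sym 𝒱 →ₗ[K] V} (hq : HasDegree 𝒱 𝒱 k q)
    {v : V} (hv : v ∈ 𝒱 i) : gradedComm k i (coderOfCorestriction 𝒱 q) (mulι 𝒱 v) =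
      coderOfCorestriction 𝒱 (q ∘ₗ mulι 𝒱 v) := by
  refine LinearMap.ext fun w => ?_
  simp only [gradedComm_apply, LinearMap.sub_apply, Module.End.mul_apply, mulι_apply,
    LinearMap.smul_apply, coderOfCorestriction_ι_mul hq hv, add_sub_cancel_right]

theorem coderOfCorestriction_hasDegree {k : ℤ} {q : Sym 𝒱 →ₗ[K] V} (hq : HasDegree 𝒱 𝒱 k q) :
    HasDegree 𝒱 (symGr 𝒱) k (coderOfCorestriction 𝒱 q) := by
  intro m w hw
  induction hw using symGr_induction generalizing k q with
  | one => rw [coderOfCorestriction_one]; exact ι_mem_symGr (hq 0 1 one_mem_symGr)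
  | zero m => rw [map_zero]; exact zero_mem _
  | add m w w' _ _ h h' => rw [map_add]; exact add_mem (h hq) (h' hq)
  | smul m c w _ h => rw [map_smul]; exact Submodule.smul_mem _ c (h hq)
  | mul i m v w hv _ h =>
    rw [coderOfCorestriction_ι_mul hq hv]
    refine add_mem ?_ (Submodule.smul_mem _ _ ?_)
    · have := h (hq.comp_mulι hv)
      rwa [show m + (k + i) = i + m + k by ring] at this
    · have := ι_mul_mem_symGr hv (h hq)
      rwa [← add_assoc] at this

/-- The operator `α ⊗ id + id ⊗ α` on `S V ⊗ S V`, with Koszul signs for `α` of degree `n`. -/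
def tensorOp (𝒱 : ℤ → Submodule K V) [DirectSum.Decomposition 𝒱] (n : ℤ)
    (α : Module.End K (Sym 𝒱)) : Module.End K (Sym 𝒱 ⊗[K] Sym 𝒱) :=
  TensorProduct.map α LinearMap.id + TensorProduct.map (sign 𝒱 n).toLinearMap α

theorem tensorOp_tmul (n : ℤ) (α : Module.End K (Sym 𝒱)) (a b : Sym 𝒱) :
    tensorOp 𝒱 n α (a ⊗ₜ b) = α a ⊗ₜ b + sign 𝒱 n a ⊗ₜ α b := rfl

theorem mem_coder {n : ℤ} {α : Module.End K (Sym 𝒱)} : α ∈ coder 𝒱 n ↔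
    HasDegree 𝒱 (symGr 𝒱) n α ∧ ∀ w, comul 𝒱 (α w) = tensorOp 𝒱 n α (comul 𝒱 w) :=
  ⟨fun h => ⟨h.1, fun w => LinearMap.congr_fun h.2 w⟩, fun h => ⟨h.1, LinearMap.ext h.2⟩⟩

theorem tensorOp_comulOp {k i : ℤ} {q : Sym 𝒱 →ₗ[K] V} (hq : HasDegree 𝒱 𝒱 k q)
    {v : V} (hv : v ∈ 𝒱 i) (t : Sym 𝒱 ⊗[K] Sym 𝒱) :
    tensorOp 𝒱 k (coderOfCorestriction 𝒱 q) (comulOp 𝒱 v t) =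
      tensorOp 𝒱 (k + i) (coderOfCorestriction 𝒱 (q ∘ₗ mulι 𝒱 v)) t +
      (-1 : K) ^ (k * i) • comulOp 𝒱 v (tensorOp 𝒱 k (coderOfCorestriction 𝒱 q) t) := by
  induction t using TensorProduct.induction_on with
  | zero => simp
  | add x y hx hy => simp only [map_add, hx, hy, smul_add]; abel
  | tmul a b =>
    simp only [tensorOp_tmul, comulOp_tmul hv, map_add, coderOfCorestriction_ι_mul hq hv,
      mulι_sign hv, sign_comp, (coderOfCorestriction_hasDegree hq).sign_apply,
      TensorProduct.add_tmul, TensorProduct.tmul_add, TensorProduct.tmul_smul,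
      ← TensorProduct.smul_tmul', smul_add, mul_comm i k, add_comm i k]
    abel

theorem comul_ι {i : ℤ} {v : V} (hv : v ∈ 𝒱 i) :
    comul 𝒱 (ι 𝒱 v) = ι 𝒱 v ⊗ₜ 1 + 1 ⊗ₜ ι 𝒱 v := by
  have h := comul_ι_mul 𝒱 v 1
  rwa [comul_one, comulOp_tmul hv, mul_one, map_one] at h

/-- The induction on the argument has to run over all corestrictions at once, since the value at `v
⊙ w` involves the corestriction `q (v ⊙ ·)`. -/
theorem coderOfCorestriction_mem {k : ℤ} {q : Sym 𝒱 →ₗ[K] V} (hq : HasDegree 𝒱 𝒱 k q) :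
    coderOfCorestriction 𝒱 q ∈ coder 𝒱 k := by
  refine mem_coder.2 ⟨coderOfCorestriction_hasDegree hq, fun w => ?_⟩
  induction w using sym_induction (𝒱 := 𝒱) generalizing k q with
  | one =>
    rw [coderOfCorestriction_one, comul_one, tensorOp_tmul, coderOfCorestriction_one,
      comul_ι (hq 0 1 one_mem_symGr), map_one (sign 𝒱 k)]
  | add w w' hw hw' => simp only [map_add, hw hq, hw' hq]
  | smul c w hw => simp only [map_smul, hw hq]
  | mul i v w hv hw =>
    rw [coderOfCorestriction_ι_mul hq hv, map_add, map_smul, comul_ι_mul, comul_ι_mul,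
      hw hq, hw (hq.comp_mulι hv), tensorOp_comulOp hq hv]

theorem mulι_mem_coder {i : ℤ} {v : V} (hv : v ∈ 𝒱 i) : mulι 𝒱 v ∈ coder 𝒱 i := by
  refine mem_coder.2 ⟨mulι_hasDegree hv, fun w => ?_⟩
  rw [mulι_apply, comul_ι_mul]
  refine LinearMap.congr_fun (TensorProduct.ext' fun a b => ?_) (comul 𝒱 w)
  rw [comulOp_tmul hv, tensorOp_tmul, mulι_apply, mulι_apply]

theorem tensorOp_comm {m n : ℤ} {α β : Module.End K (Sym 𝒱)}
    (hα : HasDegree 𝒱 (symGr 𝒱) m α) (hβ : HasDegree 𝒱 (symGr 𝒱) n β)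
    (t : Sym 𝒱 ⊗[K] Sym 𝒱) : tensorOp 𝒱 (m + n) (gradedComm m n α β) t =
      tensorOp 𝒱 m α (tensorOp 𝒱 n β t) -
        (-1 : K) ^ (m * n) • tensorOp 𝒱 n β (tensorOp 𝒱 m α t) := by
  induction t using TensorProduct.induction_on with
  | zero => simp
  | add x y hx hy => simp only [map_add, hx, hy, smul_add]; abel
  | tmul a b =>
    simp only [tensorOp_tmul, map_add, gradedComm_apply, LinearMap.sub_apply, LinearMap.smul_apply,
      Module.End.mul_apply, sign_comp, hα.sign_apply, hβ.sign_apply,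
      TensorProduct.sub_tmul, TensorProduct.tmul_sub, TensorProduct.tmul_smul,
      ← TensorProduct.smul_tmul', smul_add, mul_comm n m, add_comm n m]
    rcases neg_one_zpow_eq_or (K := K) (m * n) with h | h <;> rw [h] <;> module

theorem gradedComm_mem_coder {m n : ℤ} {α β : Module.End K (Sym 𝒱)} (hα : α ∈ coder 𝒱 m)
    (hβ : β ∈ coder 𝒱 n) : gradedComm m n α β ∈ coder 𝒱 (m + n) := by
  rw [mem_coder] at *
  refine ⟨gradedComm_hasDegree hα.1 hβ.1, fun w => ?_⟩
  rw [tensorOp_comm hα.1 hβ.1, ← hα.2, ← hβ.2, ← hα.2, ← hβ.2]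
  simp only [gradedComm_apply, LinearMap.sub_apply, LinearMap.smul_apply, Module.End.mul_apply,
    map_sub, map_smul]

end Coderivations

/-! ### The counit and the corestrictions of low arity -/

section Counit

variable (𝒱 : ℤ → Submodule K V)

theorem proj_one : proj 𝒱 (1 : Sym 𝒱) = 0 := corestriction_one _ _

theorem proj_ι (v : V) : proj 𝒱 (ι 𝒱 v) = v := corestriction_ι _ _ v

/-- The counit `S V → K`. -/
def counit : Sym 𝒱 →ₐ[K] K := lift 0 fun _ _ _ _ _ _ => by simp

variable {𝒱}

@[simp]
theorem counit_ι (v : V) : counit 𝒱 (ι 𝒱 v) = 0 := lift_ι _ _ v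

theorem counit_ι_mul (v : V) (w : Sym 𝒱) : counit 𝒱 (ι 𝒱 v * w) = 0 := by
  rw [map_mul, counit_ι, zero_mul]

theorem counit_eq_zero {m : ℤ} (hm : m ≠ 0) {w : Sym 𝒱} (hw : w ∈ symGr 𝒱 m) :
    counit 𝒱 w = 0 := by
  induction hw using symGr_induction with
  | one => exact absurd rfl hm
  | zero m => exact map_zero _
  | add m w w' _ _ h h' => rw [map_add, h hm, h' hm, add_zero]
  | smul m c w _ h => rw [map_smul, h hm, smul_zero]
  | mul i m v w _ _ _ => exact counit_ι_mul v w

variable [DirectSum.Decomposition 𝒱]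

theorem counit_sign (n : ℤ) (w : Sym 𝒱) : counit 𝒱 (sign 𝒱 n w) = counit 𝒱 w :=
  DFunLike.congr_fun (algHom_ext (f := (counit 𝒱).comp (sign 𝒱 n)) (g := counit 𝒱) fun v => by
    simp only [AlgHom.comp_apply, sign_ι, counit_ι]) w

/-- `(ε ⊗ id) Δ = id`. -/
theorem counit_comul (w : Sym 𝒱) : LinearMap.mul' K (Sym 𝒱) (TensorProduct.map
    (Algebra.linearMap K (Sym 𝒱) ∘ₗ (counit 𝒱).toLinearMap) LinearMap.id (comul 𝒱 w)) = w := by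
  induction w using sym_induction (𝒱 := 𝒱) with
  | one => simp [comul_one]
  | add w w' hw hw' => simp only [map_add, hw, hw']
  | smul c w hw => simp only [map_smul, hw]
  | mul i v w hv hw =>
    have h : LinearMap.mul' K (Sym 𝒱) ∘ₗ TensorProduct.map
        (Algebra.linearMap K (Sym 𝒱) ∘ₗ (counit 𝒱).toLinearMap) LinearMap.id ∘ₗ comulOp 𝒱 v =
        mulι 𝒱 v ∘ₗ LinearMap.mul' K (Sym 𝒱) ∘ₗ TensorProduct.map
        (Algebra.linearMap K (Sym 𝒱) ∘ₗ (counit 𝒱).toLinearMap) LinearMap.id := by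
      refine TensorProduct.ext' fun a b => ?_
      simp only [LinearMap.comp_apply, comulOp_tmul hv, map_add, TensorProduct.map_tmul,
        AlgHom.toLinearMap_apply, counit_ι_mul, counit_sign, Algebra.linearMap_apply, map_zero,
        LinearMap.mul'_apply, LinearMap.id_apply, mulι_apply, zero_mul, zero_add]
      rw [← Algebra.smul_def, ← Algebra.smul_def, mul_smul_comm]
    rw [comul_ι_mul]
    refine (LinearMap.congr_fun h (comul 𝒱 w)).trans ?_
    simp only [LinearMap.comp_apply, hw, mulι_apply]

/-- The coderivation with corestriction `v` on `V^{⊙ 0} = K` and zero elsewhere is the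
multiplication by `v`. -/
theorem coderOfCorestriction_counit_smulRight (v : V) :
    coderOfCorestriction 𝒱 ((counit 𝒱).toLinearMap.smulRight v) = mulι 𝒱 v := by
  refine LinearMap.ext fun w => ?_
  conv_rhs => rw [← counit_comul w]
  refine LinearMap.congr_fun (f := LinearMap.mul' K (Sym 𝒱) ∘ₗ
    TensorProduct.map (ι 𝒱 ∘ₗ (counit 𝒱).toLinearMap.smulRight v) LinearMap.id)
    (g := mulι 𝒱 v ∘ₗ LinearMap.mul' K (Sym 𝒱) ∘ₗ TensorProduct.map
        (Algebra.linearMap K (Sym 𝒱) ∘ₗ (counit 𝒱).toLinearMap) LinearMap.id)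
    (TensorProduct.ext' fun a b => ?_) (comul 𝒱 w)
  simp only [LinearMap.comp_apply, TensorProduct.map_tmul, LinearMap.smulRight_apply,
    AlgHom.toLinearMap_apply, Algebra.linearMap_apply, LinearMap.mul'_apply, LinearMap.id_apply,
    mulι_apply, map_smul, smul_mul_assoc, ← Algebra.smul_def]

end Counit

section Corestriction

variable {𝒱 : ℤ → Submodule K V} [DirectSum.Decomposition 𝒱] {B : V →ₗ[K] V →ₗ[K] V}

theorem lift_corestrictionOp_fst (hB : GradedSymmetric 𝒱 B) (w : Sym 𝒱) :
    (lift (corestrictionOp B) (corestrictionOp_comm hB) w (1, 0, 0)).1 = counit 𝒱 w := by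
  induction w using sym_induction (𝒱 := 𝒱) with
  | one => simp
  | add w w' hw hw' => simp only [map_add, LinearMap.add_apply, Prod.fst_add, hw, hw']
  | smul c w hw => simp only [map_smul, LinearMap.smul_apply, Prod.smul_fst, hw]
  | mul i v w hv hw =>
    rw [map_mul, lift_ι, Module.End.mul_apply, corestrictionOp_apply, counit_ι_mul]

theorem proj_ι_mul (v : V) (w : Sym 𝒱) : proj 𝒱 (ι 𝒱 v * w) = counit 𝒱 w • v := by
  rw [← lift_corestrictionOp_fst (B := 0) (fun _ _ _ _ _ _ => by simp)]
  simp [proj, corestriction]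

theorem corestriction_ι_mul (f : V →ₗ[K] V) (hB : GradedSymmetric 𝒱 B) (v : V) (w : Sym 𝒱) :
    corestriction f hB (ι 𝒱 v * w) = counit 𝒱 w • f v + B v (proj 𝒱 w) := by
  have h : (lift (corestrictionOp B) (corestrictionOp_comm hB) w (1, 0, 0)).2.1 = proj 𝒱 w := by
    induction w using sym_induction (𝒱 := 𝒱) with
    | one => simp [proj_one]
    | add w w' hw hw' => simp only [map_add, LinearMap.add_apply, Prod.snd_add, Prod.fst_add, hw,
        hw']
    | smul c w hw => simp only [map_smul, LinearMap.smul_apply, Prod.smul_snd, Prod.smul_fst, hw]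
    | mul i v w hv hw =>
      rw [map_mul, lift_ι, Module.End.mul_apply, corestrictionOp_apply,
        lift_corestrictionOp_fst hB, proj_ι_mul]
  rw [← h, ← lift_corestrictionOp_fst hB]
  simp [corestriction]

theorem proj_hasDegree : HasDegree 𝒱 𝒱 0 (proj 𝒱) := by
  intro m w hw
  induction hw using symGr_induction with
  | one => rw [proj_one]; exact zero_mem _
  | zero m => rw [map_zero]; exact zero_mem _
  | add m w w' _ _ h h' => rw [map_add]; exact add_mem h h'
  | smul m c w _ h => rw [map_smul]; exact Submodule.smul_mem _ c h
  | mul i m v w hv hw _ =>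
    rw [proj_ι_mul]
    rcases eq_or_ne m 0 with rfl | hm
    · rw [add_zero, add_zero]; exact Submodule.smul_mem _ _ hv
    · rw [counit_eq_zero hm hw, zero_smul]; exact zero_mem _

theorem corestriction_hasDegree {k : ℤ} {f : V →ₗ[K] V} (hB : GradedSymmetric 𝒱 B)
    (hf : ∀ i, ∀ v ∈ 𝒱 i, f v ∈ 𝒱 (i + k))
    (hBk : ∀ i j, ∀ v ∈ 𝒱 i, ∀ w ∈ 𝒱 j, B v w ∈ 𝒱 (i + j + k)) :
    HasDegree 𝒱 𝒱 k (corestriction f hB) := by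
  intro m w hw
  induction hw using symGr_induction with
  | one => rw [corestriction_one]; exact zero_mem _
  | zero m => rw [map_zero]; exact zero_mem _
  | add m w w' _ _ h h' => rw [map_add]; exact add_mem h h'
  | smul m c w _ h => rw [map_smul]; exact Submodule.smul_mem _ c h
  | mul i m v w hv hw _ =>
    rw [corestriction_ι_mul]
    refine add_mem ?_ (hBk _ _ _ hv _ ?_)
    · rcases eq_or_ne m 0 with rfl | hm
      · rw [add_zero]; exact Submodule.smul_mem _ _ (hf _ _ hv)
      · rw [counit_eq_zero hm hw, zero_smul]; exact zero_mem _
    · have := proj_hasDegree m w hw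
      rwa [add_zero] at this

theorem comp_proj_hasDegree {k : ℤ} {f : V →ₗ[K] V}
    (hf : ∀ i, ∀ v ∈ 𝒱 i, f v ∈ 𝒱 (i + k)) : HasDegree 𝒱 𝒱 k (f ∘ₗ proj 𝒱) := by
  intro m w hw
  have := proj_hasDegree m w hw
  rw [add_zero] at this
  exact hf m _ this

variable (𝒱) in
/-- The coderivation with corestriction `f` on `V`, and zero on the other `V^{⊙ n}`. -/
def extend (f : V →ₗ[K] V) : Module.End K (Sym 𝒱) := coderOfCorestriction 𝒱 (f ∘ₗ proj 𝒱)

theorem extend_one (f : V →ₗ[K] V) : extend 𝒱 f 1 = 0 := by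
  rw [extend, coderOfCorestriction_one, LinearMap.comp_apply, proj_one, map_zero, map_zero]

theorem gradedComm_extend_mulι {k i : ℤ} {f : V →ₗ[K] V} (hf : ∀ i, ∀ v ∈ 𝒱 i, f v ∈ 𝒱 (i + k))
    {v : V} (hv : v ∈ 𝒱 i) : gradedComm k i (extend 𝒱 f) (mulι 𝒱 v) = mulι 𝒱 (f v) := by
  rw [extend, gradedComm_coderOfCorestriction (comp_proj_hasDegree hf) hv,
    ← coderOfCorestriction_counit_smulRight (f v)]
  congr 1
  ext w
  simp [proj_ι_mul]

theorem coderOfCorestriction_add (q q' : Sym 𝒱 →ₗ[K] V) :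
    coderOfCorestriction 𝒱 (q + q') = coderOfCorestriction 𝒱 q + coderOfCorestriction 𝒱 q' := by
  simp only [coderOfCorestriction, LinearMap.comp_add, LinearMap.add_comp,
      TensorProduct.map_add_left]

theorem coderOfCorestriction_smul (c : K) (q : Sym 𝒱 →ₗ[K] V) :
    coderOfCorestriction 𝒱 (c • q) = c • coderOfCorestriction 𝒱 q := by
  simp only [coderOfCorestriction, LinearMap.comp_smul, LinearMap.smul_comp,
    TensorProduct.map_smul_left]

theorem gradedComm_coderOfCorestriction_corestriction {k i : ℤ} {f : V →ₗ[K] V}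
    (hB : GradedSymmetric 𝒱 B) (hf : ∀ i, ∀ v ∈ 𝒱 i, f v ∈ 𝒱 (i + k))
    (hBk : ∀ i j, ∀ v ∈ 𝒱 i, ∀ w ∈ 𝒱 j, B v w ∈ 𝒱 (i + j + k)) {v : V} (hv : v ∈ 𝒱 i) :
    gradedComm k i (coderOfCorestriction 𝒱 (corestriction f hB)) (mulι 𝒱 v) =
      mulι 𝒱 (f v) + extend 𝒱 (B v) := by
  rw [gradedComm_coderOfCorestriction (corestriction_hasDegree hB hf hBk) hv,
    ← coderOfCorestriction_counit_smulRight (f v), extend, ← coderOfCorestriction_add]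
  congr 1
  ext w
  simp [corestriction_ι_mul]

end Corestriction

/-! ### Primitive elements -/

section Primitive

variable {𝒱 : ℤ → Submodule K V} [DirectSum.Decomposition 𝒱]

variable (𝒱) in
/-- The Euler operator, multiplication by `n` on `V^{⊙ n}`. -/
def euler : Module.End K (Sym 𝒱) := extend 𝒱 LinearMap.id

theorem euler_ι_mul {i : ℤ} {v : V} (hv : v ∈ 𝒱 i) (w : Sym 𝒱) :
    euler 𝒱 (ι 𝒱 v * w) = ι 𝒱 v * w + ι 𝒱 v * euler 𝒱 w := by
  have := LinearMap.congr_fun (gradedComm_extend_mulι (𝒱 := 𝒱) (k := 0) (f := LinearMap.id)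
    (fun i v hv => by simpa using hv) hv) w
  simp only [gradedComm_apply, LinearMap.sub_apply, Module.End.mul_apply,
    mulι_apply, zero_mul, zpow_zero, one_smul, LinearMap.id_apply] at this
  exact sub_eq_iff_eq_add.1 this

theorem euler_one : euler 𝒱 1 = 0 := extend_one _

/-- `S V` is the sum of `K` and of the eigenspaces of the Euler operator for positive integers. -/
theorem exists_eq_smul_one_add (w : Sym 𝒱) : ∃ c : K, ∃ u ∈ ⨆ n : ℕ,
    (euler 𝒱).eigenspace ((n : K) + 1), w = c • 1 + u := by
  induction w using sym_induction (𝒱 := 𝒱) with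
  | one => exact ⟨1, 0, zero_mem _, by simp⟩
  | add w w' hw hw' =>
    obtain ⟨c, u, hu, rfl⟩ := hw
    obtain ⟨c', u', hu', rfl⟩ := hw'
    exact ⟨c + c', u + u', add_mem hu hu', by rw [add_smul]; abel⟩
  | smul c w hw =>
    obtain ⟨c', u, hu, rfl⟩ := hw
    exact ⟨c * c', c • u, Submodule.smul_mem _ c hu, by rw [smul_add, smul_smul]⟩
  | mul i v w hv hw =>
    obtain ⟨c, u, hu, rfl⟩ := hw
    refine ⟨0, ι 𝒱 v * (c • 1 + u), ?_, by rw [zero_smul, zero_add]⟩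
    rw [mul_add]
    refine add_mem (Submodule.mem_iSup_of_mem 0 ?_) ?_
    · rw [Module.End.mem_eigenspace_iff, euler_ι_mul hv, map_smul, euler_one]
      simp
    · refine Submodule.iSup_induction _ (motive := fun u => ι 𝒱 v * u ∈ ⨆ n : ℕ,
        (euler 𝒱).eigenspace ((n : K) + 1)) hu (fun n u hu => ?_) ?_ ?_
      · refine Submodule.mem_iSup_of_mem (n + 1) ?_
        rw [Module.End.mem_eigenspace_iff] at hu ⊢
        rw [euler_ι_mul hv, hu, mul_smul_comm, Nat.cast_add, Nat.cast_one]
        module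
      · rw [mul_zero]; exact zero_mem _
      · intro x y hx hy; rw [mul_add]; exact add_mem hx hy

theorem eq_smul_one_of_euler_eq_zero [CharZero K] {w : Sym 𝒱} (hw : euler 𝒱 w = 0) :
    ∃ c : K, w = c • 1 := by
  obtain ⟨c, u, hu, rfl⟩ := exists_eq_smul_one_add w
  refine ⟨c, ?_⟩
  rw [map_add, map_smul, euler_one, smul_zero, zero_add] at hw
  have h0 : u ∈ (euler 𝒱).eigenspace 0 := by
    rw [Module.End.mem_eigenspace_iff, hw, zero_smul]
  have hle : ⨆ n : ℕ, (euler 𝒱).eigenspace ((n : K) + 1) ≤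
      ⨆ μ : K, ⨆ (_ : μ ≠ 0), (euler 𝒱).eigenspace μ :=
    iSup_le fun n => le_iSup₂_of_le ((n : K) + 1) (by exact_mod_cast Nat.succ_ne_zero n) le_rfl
  have := Submodule.disjoint_def.1 ((euler 𝒱).eigenspaces_iSupIndep 0) u h0 (hle hu)
  rw [this, add_zero]

/-- The primitive elements of `S V` are the elements of `V`. On a primitive element the Euler
operator acts as the projection to `V`, and its kernel is `K`. -/
theorem eq_ι_proj_of_primitive [CharZero K] {w : Sym 𝒱}
    (hw : comul 𝒱 w = w ⊗ₜ 1 + 1 ⊗ₜ w) : w = ι 𝒱 (proj 𝒱 w) := by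
  have hε : counit 𝒱 w = 0 := by
    have h := counit_comul w
    rw [hw] at h
    simp only [map_add, TensorProduct.map_tmul, LinearMap.comp_apply, AlgHom.toLinearMap_apply,
      map_one, LinearMap.id_apply, LinearMap.mul'_apply, one_mul, mul_one,
      Algebra.linearMap_apply] at h
    have := congrArg (counit 𝒱) (add_eq_right.1 h)
    rwa [map_zero, AlgHom.commutes] at this
  have he : euler 𝒱 w = ι 𝒱 (proj 𝒱 w) := by
    simp [euler, extend, coderOfCorestriction, hw, proj_one]
  have hι : ∀ v, euler 𝒱 (ι 𝒱 v) = ι 𝒱 v := by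
    intro v
    induction v using DirectSum.Decomposition.inductionOn 𝒱 with
    | zero => simp
    | homogeneous v => simpa [euler_one] using euler_ι_mul v.2 1
    | add v v' hv hv' => rw [map_add, map_add, hv, hv']
  obtain ⟨c, hc⟩ := eq_smul_one_of_euler_eq_zero (w := w - ι 𝒱 (proj 𝒱 w))
    (by rw [map_sub, he, hι, sub_self])
  have := congrArg (counit 𝒱) hc
  rw [map_sub, hε, counit_ι, map_smul, map_one, sub_zero, smul_eq_mul, mul_one] at this
  rw [← this, zero_smul] at hc
  exact sub_eq_zero.1 hc

/-- Since `Δ 1 = 1 ⊗ 1`, a coderivation sends `1` to a primitive element. -/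
theorem coder_apply_one [CharZero K] {n : ℤ} {α : Module.End K (Sym 𝒱)} (hα : α ∈ coder 𝒱 n) :
    α 1 = ι 𝒱 (proj 𝒱 (α 1)) := by
  apply eq_ι_proj_of_primitive
  rw [(mem_coder.1 hα).2, comul_one, tensorOp_tmul, map_one (sign 𝒱 n)]

end Primitive

end GradedSym

/-! ### The DG-Lie algebra of coderivations of `S L[1]` -/

namespace DGLieAlgebra

open GradedSym

variable {K : Type u} [Field K] (L : DGLieAlgebra K)

theorem mem_shiftGr_sub_one {m : ℤ} {x : L.carrier} : x ∈ L.shiftGr (m - 1) ↔ x ∈ L.gr m := by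
  rw [shiftGr, sub_add_cancel]

theorem q₂_apply {m : ℤ} {x : L.carrier} (hx : x ∈ L.gr m) (y : L.carrier) :
    L.q₂ x y = (-1 : K) ^ m • L.bracket x y := by
  rw [L.q₂_of_mem (L.mem_shiftGr_sub_one.2 hx), neg_one_zpow_sub, zpow_one]
  module

theorem q₂_mem {m : ℤ} {x : L.carrier} (hx : x ∈ L.gr m) (i : ℤ) (y : L.carrier)
    (hy : y ∈ L.shiftGr i) : L.q₂ x y ∈ L.shiftGr (i + m) := by
  rw [L.q₂_apply hx, shiftGr, show i + m + 1 = m + (i + 1) by ring]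
  exact Submodule.smul_mem _ _ (L.bracket_mem hx hy)

theorem q₁_mem (i : ℤ) (x : L.carrier) (hx : x ∈ L.shiftGr i) : L.q₁ x ∈ L.shiftGr (i + 1) :=
  neg_mem (L.d_mem hx)

/-- The coderivation `ad x` with corestriction `q₂ (x ⊙ ·)` on `L[1]`, and zero elsewhere. -/
def ad : L.carrier →ₗ[K] Module.End K L.SymShift where
  toFun x := extend L.shiftGr (L.q₂ x)
  map_add' x y := by
    rw [map_add, extend, LinearMap.add_comp, coderOfCorestriction_add]; rfl
  map_smul' c x := by
    rw [map_smul, extend, LinearMap.smul_comp, coderOfCorestriction_smul]; rfl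

theorem ad_one (x : L.carrier) : L.ad x 1 = 0 := extend_one _

theorem ad_mem {m : ℤ} {x : L.carrier} (hx : x ∈ L.gr m) : L.ad x ∈ L.coder m :=
  coderOfCorestriction_mem (comp_proj_hasDegree (L.q₂_mem hx))

theorem gradedComm_ad_mulι {m i : ℤ} {x v : L.carrier} (hx : x ∈ L.gr m) (hv : v ∈ L.shiftGr i) :
    gradedComm m i (L.ad x) (mulι L.shiftGr v) = (-1 : K) ^ m • mulι L.shiftGr (L.bracket x v) := by
  rw [← map_smul, ← L.q₂_apply hx]
  exact gradedComm_extend_mulι (L.q₂_mem hx) hv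

theorem corestriction_q_hasDegree :
    HasDegree L.shiftGr L.shiftGr 1 (corestriction L.q₁ L.q₂_symm) :=
  corestriction_hasDegree _ L.q₁_mem fun i j v hv w hw => by
    have := L.q₂_mem (show v ∈ L.gr (i + 1) from hv) j w hw
    rwa [show j + (i + 1) = i + j + 1 by ring] at this

theorem Q_mem : L.Q ∈ L.coder 1 := coderOfCorestriction_mem L.corestriction_q_hasDegree

theorem Q_one : L.Q 1 = 0 := by
  rw [Q, coderOfCorestriction_one, corestriction_one, map_zero]

/-- Cartan formula: `[Q, v ⊙ ·] = ad v - (d v ⊙ ·)`. -/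
theorem gradedComm_Q_mulι {i : ℤ} {v : L.carrier} (hv : v ∈ L.shiftGr i) :
    gradedComm 1 i L.Q (mulι L.shiftGr v) = L.ad v - mulι L.shiftGr (L.d v) := by
  have h := gradedComm_coderOfCorestriction_corestriction L.q₂_symm L.q₁_mem (fun i j v hv w hw =>
      by
    have := L.q₂_mem (show v ∈ L.gr (i + 1) from hv) j w hw
    rwa [show j + (i + 1) = i + j + 1 by ring] at this) hv
  refine h.trans ?_
  rw [q₁, LinearMap.neg_apply, map_neg, neg_add_eq_sub]
  rfl

theorem Q_ι {i : ℤ} {v : L.carrier} (hv : v ∈ L.shiftGr i) :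
    L.Q (ι L.shiftGr v) = ι L.shiftGr (L.q₁ v) := by
  have := LinearMap.congr_fun (L.gradedComm_Q_mulι hv) 1
  simp only [gradedComm_apply, LinearMap.sub_apply, LinearMap.smul_apply, Module.End.mul_apply,
    mulι_apply, mul_one, L.Q_one, mul_zero, smul_zero, sub_zero, L.ad_one, zero_sub] at this
  rw [this, q₁, LinearMap.neg_apply, map_neg]

theorem gradedComm_ad_ad {m n : ℤ} {x y : L.carrier} (hx : x ∈ L.gr m) (hy : y ∈ L.gr n) :
    gradedComm m n (L.ad x) (L.ad y) = L.ad (L.bracket x y) := by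
  refine end_ext (𝒱 := L.shiftGr) (m + n) ?_ fun i v hv => ?_
  · simp [gradedComm_apply, ad_one]
  · have hj := gradedComm_jacobi m n i (L.ad x) (L.ad y) (mulι L.shiftGr v)
    have hyv : L.bracket y v ∈ L.shiftGr (n + i) := by
      rw [shiftGr, add_assoc]; exact L.bracket_mem hy hv
    have hxv : L.bracket x v ∈ L.shiftGr (m + i) := by
      rw [shiftGr, add_assoc]; exact L.bracket_mem hx hv
    rw [L.gradedComm_ad_mulι hy hv, L.gradedComm_ad_mulι hx hv, map_smul, map_smul,
        L.gradedComm_ad_mulι hx hyv,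
      L.gradedComm_ad_mulι hy hxv] at hj
    rw [L.gradedComm_ad_mulι (L.bracket_mem hx hy) hv, ← sub_eq_iff_eq_add.2 hj, neg_one_zpow_add,
      L.jacobi v hx hy, map_add, map_smul]
    rcases neg_one_zpow_eq_or (K := K) m with h | h <;>
    rcases neg_one_zpow_eq_or (K := K) n with h' | h' <;>
    rw [h, h'] <;> module

theorem gradedComm_Q_ad {m : ℤ} {x : L.carrier} (hx : x ∈ L.gr m) :
    gradedComm 1 m L.Q (L.ad x) = L.ad (L.d x) := by
  refine end_ext (𝒱 := L.shiftGr) (1 + m) ?_ fun i v hv => ?_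
  · simp [gradedComm_apply, ad_one, Q_one]
  · have hj := gradedComm_jacobi 1 m i L.Q (L.ad x) (mulι L.shiftGr v)
    have hxv : L.bracket x v ∈ L.shiftGr (m + i) := by
      rw [shiftGr, add_assoc]; exact L.bracket_mem hx hv
    have hdv : L.d v ∈ L.shiftGr (1 + i) := by
      rw [shiftGr, add_comm 1 i]; exact L.d_mem hv
    have hv' : v ∈ L.gr (1 + i) := by rw [add_comm]; exact hv
    have hdx : L.d x ∈ L.gr (1 + m) := by rw [add_comm]; exact L.d_mem hx
    rw [L.gradedComm_ad_mulι hx hv, L.gradedComm_Q_mulι hv, map_smul, L.gradedComm_Q_mulι hxv,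
        map_sub,
      L.gradedComm_ad_ad hx hv', L.gradedComm_ad_mulι hx hdv, one_mul, L.leibniz v hx] at hj
    rw [L.gradedComm_ad_mulι hdx hv, ← sub_eq_iff_eq_add.2 hj, neg_one_zpow_add, zpow_one, map_add,
      map_smul]
    rcases neg_one_zpow_eq_or (K := K) m with h | h <;> rw [h] <;> module

theorem gradedComm_Q_gradedComm_Q (n : ℤ) (α : Module.End K L.SymShift) :
    gradedComm 1 (1 + n) L.Q (gradedComm 1 n L.Q α) = gradedComm 2 n (L.Q * L.Q) α := by
  simp only [gradedComm_apply, one_mul, neg_one_zpow_add, zpow_one, mul_sub, sub_mul, mul_smul_comm,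
    smul_mul_assoc, mul_assoc, (even_two_mul n).neg_one_zpow]
  rcases neg_one_zpow_eq_or (K := K) n with h | h <;> rw [h] <;> module

/-- `Q² = 0`: by the Cartan formula, `[Q², v ⊙ ·] = [Q, [Q, v ⊙ ·]]` vanishes. -/
theorem Q_mul_Q : L.Q * L.Q = 0 := by
  refine end_ext (𝒱 := L.shiftGr) 2 ?_ fun i v hv => ?_
  · rw [Module.End.mul_apply, Q_one, map_zero, LinearMap.zero_apply]
  · have hdv : L.d v ∈ L.shiftGr (1 + i) := by
      rw [shiftGr, add_comm 1 i]; exact L.d_mem hv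
    have hv' : v ∈ L.gr (1 + i) := by rw [add_comm]; exact hv
    rw [← gradedComm_Q_gradedComm_Q, L.gradedComm_Q_mulι hv, map_sub, L.gradedComm_Q_ad hv',
        L.gradedComm_Q_mulι hdv, L.d_d,
      map_zero, sub_zero, sub_self, map_zero, LinearMap.zero_apply]

/-- The DG-Lie algebra `Coder^*(S L[1])`, with the graded commutator and the differential `[Q, ]`.
-/
abbrev coderPieces : DGLiePieces K where
  E := Module.End K L.SymShift
  P := L.coder
  br := gradedComm
  br_mem := gradedComm_mem_coder
  skew _ _ := gradedComm_skew _ _ _ _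
  jacobi _ _ _ := gradedComm_jacobi _ _ _ _ _ _
  d n := gradedComm 1 n L.Q
  d_mem {i x} hx := by
    rw [add_comm]; exact gradedComm_mem_coder L.Q_mem hx
  d_d {i x} _ := by
    rw [add_comm, gradedComm_Q_gradedComm_Q, Q_mul_Q, map_zero, LinearMap.zero_apply]
  leibniz {i j x y} _ _ := by
    rw [gradedComm_jacobi, one_mul, add_comm 1 i, add_comm 1 j]

/-- The DG-Lie subalgebra of the coderivations that kill `1`. -/
abbrev coderKilling : L.coderPieces.Sub where
  N n := L.coder n ⊓ LinearMap.ker (LinearMap.applyₗ (R := K) (1 : L.SymShift))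
  le _ := inf_le_left
  br_mem {m n α β} hα hβ := by
    have h1 : α 1 = 0 := hα.2
    have h2 : β 1 = 0 := hβ.2
    refine ⟨gradedComm_mem_coder hα.1 hβ.1, ?_⟩
    change gradedComm m n α β 1 = 0
    simp [gradedComm_apply, h1, h2]
  d_mem {n α} hα := by
    have h1 : α 1 = 0 := hα.2
    refine ⟨L.coderPieces.d_mem hα.1, ?_⟩
    change gradedComm 1 n L.Q α 1 = 0
    simp [gradedComm_apply, h1, Q_one]

theorem mem_coderKilling {n : ℤ} {α : Module.End K L.SymShift} :
    α ∈ L.coderKilling.N n ↔ α ∈ L.coder n ∧ α 1 = 0 := Iff.rfl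

theorem gradedComm_mulι_mulι {m n : ℤ} {v w : L.carrier} (hv : v ∈ L.shiftGr m) (hw : w ∈ L.shiftGr
    n) :
    gradedComm m n (mulι L.shiftGr v) (mulι L.shiftGr w) = 0 := by
  refine LinearMap.ext fun z => ?_
  simp only [gradedComm_apply, LinearMap.sub_apply, LinearMap.smul_apply, Module.End.mul_apply,
    mulι_apply, ← mul_assoc, ι_mul_ι hv hw, smul_mul_assoc, sub_self, LinearMap.zero_apply]

theorem gradedComm_mulι_ad {m n : ℤ} {v y : L.carrier} (hv : v ∈ L.shiftGr m) (hy : y ∈ L.gr n) :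
    gradedComm m n (mulι L.shiftGr v) (L.ad y) = mulι L.shiftGr (L.bracket v y) := by
  rw [gradedComm_skew, L.gradedComm_ad_mulι hy hv, L.skew hv hy, map_neg, map_smul, add_mul,
    neg_one_zpow_add, one_mul, smul_smul]

/-- The morphism `x + ε y ↦ ad x + (y ⊙ ·)` from the cone of `L` to `Coder^*(S L[1])`. -/
def coneToCoder : DGLiePieces.Hom L.cone L.coderPieces where
  φ := L.ad.coprod (mulι L.shiftGr)
  map_mem := by
    rintro n ⟨x, y⟩ ⟨hx, hy⟩
    change y ∈ L.gr (n - -1) at hy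
    rw [sub_neg_eq_add] at hy
    change L.ad x + mulι L.shiftGr y ∈ L.coder n
    exact add_mem (L.ad_mem hx) (mulι_mem_coder (𝒱 := L.shiftGr) hy)
  map_d := by
    rintro n ⟨x, y⟩ ⟨hx, hy⟩
    change y ∈ L.gr (n - -1) at hy
    rw [sub_neg_eq_add] at hy
    change L.ad (L.d x + y) + mulι L.shiftGr (-L.d y) =
      gradedComm 1 n L.Q (L.ad x + mulι L.shiftGr y)
    rw [map_add, map_add, L.gradedComm_Q_ad hx, L.gradedComm_Q_mulι hy, map_neg]
    abel
  map_br := by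
    rintro m n ⟨x, y⟩ ⟨x', y'⟩ ⟨hx, hy⟩ ⟨hx', hy'⟩
    change y ∈ L.gr (m - -1) at hy
    change y' ∈ L.gr (n - -1) at hy'
    rw [sub_neg_eq_add] at hy hy'
    change L.ad (L.bracket x x') +
        mulι L.shiftGr (L.bracket y x' + (-1 : K) ^ m • L.bracket x y') =
      gradedComm m n (L.ad x + mulι L.shiftGr y) (L.ad x' + mulι L.shiftGr y')
    rw [map_add, map_add, map_add, LinearMap.add_apply, LinearMap.add_apply,
      L.gradedComm_ad_ad hx hx', L.gradedComm_mulι_ad hy hx', L.gradedComm_ad_mulι hx hy',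
      L.gradedComm_mulι_mulι hy hy', map_smul]
    abel

theorem coder_apply_one_eq [CharZero K] {n : ℤ} {α : Module.End K L.SymShift}
    (hα : α ∈ L.coder n) : α 1 = ι L.shiftGr (L.b α) := coder_apply_one hα

theorem b_mem {n : ℤ} {α : Module.End K L.SymShift} (hα : α ∈ L.coder n) :
    L.b α ∈ L.shiftGr n := by
  have := proj_hasDegree _ _ ((mem_coder.1 hα).1 0 1 one_mem_symGr)
  rwa [zero_add, add_zero] at this

/-- `coneToCoder` identifies the quotient of the cone by `L` with the quotient of `Coder^*(S L[1])`
by the coderivations killing `1`, both being `L[1]`; the second identification is `b`. -/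
theorem exists_quasiIso_coneFiber_coderFiber [CharZero K] :
    ∃ f : Hom (L.cone.fiber L.coneBase).toDGLie (L.coderPieces.fiber L.coderKilling).toDGLie,
      f.IsQuasiIso := by
  refine ⟨_, DGLiePieces.Hom.fiberMap_isQuasiIso L.coneBase L.coderKilling L.coneToCoder
    ?_ ?_ ?_⟩
  · rintro n ⟨x, y⟩ ⟨hx, hy⟩
    refine ⟨L.coneToCoder.map_mem (L.coneBase.le n ⟨hx, hy⟩), ?_⟩
    change y = 0 at hy
    change L.ad x 1 + ι L.shiftGr y * 1 = 0
    rw [hy, map_zero, zero_mul, L.ad_one, add_zero]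
  · intro n α hα
    have hm : ((0, L.b α) : L.carrier × L.carrier) ∈ L.cone.P n := by
      refine ⟨zero_mem _, ?_⟩
      change _ ∈ L.gr (n - -1)
      rw [sub_neg_eq_add]
      exact L.b_mem hα
    refine ⟨_, hm, L.mem_coderKilling.2 ⟨sub_mem hα (L.coneToCoder.map_mem hm), ?_⟩⟩
    change α 1 - (L.ad 0 1 + ι L.shiftGr (L.b α) * 1) = 0
    rw [L.ad_one, zero_add, mul_one, ← L.coder_apply_one_eq hα, sub_self]
  · rintro n ⟨x, y⟩ ⟨hx, hy⟩ h
    have h1 : L.ad x 1 + ι L.shiftGr y * 1 = 0 := h.2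
    rw [L.ad_one, zero_add, mul_one] at h1
    refine ⟨hx, ?_⟩
    change y = 0
    rw [← proj_ι (𝒱 := L.shiftGr) y, h1, map_zero]

/-- The splitting property says that each cocycle modulo the coderivations killing `1` lifts, up to
a boundary, to a cocycle of coderivations. -/
theorem HasSplittingProperty.exists_decomposition [CharZero K] (hL : L.HasSplittingProperty)
    (n : ℤ) (γ : Module.End K L.SymShift) (hγ : γ ∈ L.coder n)
    (hd : L.coderPieces.d n γ ∈ L.coderKilling.N (n + 1)) :
    ∃ α ∈ L.coder n, L.coderPieces.d n α = 0 ∧ ∃ ν ∈ L.coderKilling.N n,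
      ∃ ρ ∈ L.coder (n - 1), γ = α + (ν + L.coderPieces.d (n - 1) ρ) := by
  have hd1 : gradedComm 1 n L.Q γ 1 = 0 := hd.2
  have hq : L.q₁ (L.b γ) = 0 := by
    simp only [gradedComm_apply, LinearMap.sub_apply, LinearMap.smul_apply, Module.End.mul_apply,
        Q_one,
      map_zero, smul_zero, sub_zero] at hd1
    rw [L.coder_apply_one_eq hγ, L.Q_ι (L.b_mem hγ)] at hd1
    rw [← proj_ι (𝒱 := L.shiftGr) (L.q₁ (L.b γ)), hd1, map_zero]
  obtain ⟨α, hα, hdα, y, hy, e⟩ := hL n _ (L.b_mem hγ) hq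
  have hdα' : gradedComm 1 n L.Q α = 0 := by
    rw [gradedComm_apply, one_mul]; exact hdα
  have hρ : -mulι L.shiftGr y ∈ L.coder (n - 1) := neg_mem (mulι_mem_coder hy)
  have hdρ : gradedComm 1 (n - 1) L.Q (-mulι L.shiftGr y) ∈ L.coder n := by
    have := L.coderPieces.d_mem hρ
    rwa [sub_add_cancel] at this
  refine ⟨α, hα, hdα', γ - α - gradedComm 1 (n - 1) L.Q (-mulι L.shiftGr y),
    L.mem_coderKilling.2 ⟨sub_mem (sub_mem hγ hα) hdρ, ?_⟩, _, hρ, by abel⟩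
  simp only [gradedComm_apply, LinearMap.sub_apply, LinearMap.smul_apply, Module.End.mul_apply,
      Q_one,
      map_zero, smul_zero, sub_zero, LinearMap.neg_apply, mulι_apply, mul_one, map_neg]
  rw [L.coder_apply_one_eq hγ, L.coder_apply_one_eq hα, L.Q_ι hy, e, map_add]
  abel

end DGLieAlgebra

end

theorem corollary4p17 {K : Type u} [Field K] [CharZero K] (L : DGLieAlgebra K)
    (hL : L.HasSplittingProperty) : L.IsHomotopyAbelian := by
  obtain ⟨A, hA, g, hg⟩ := DGLiePieces.exists_abelian_quasiIso_fiber L.coderKilling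
    (DGLieAlgebra.HasSplittingProperty.exists_decomposition L hL)
  obtain ⟨f, hf⟩ := L.exists_quasiIso_coneFiber_coderFiber
  refine ⟨A, hA, ?_⟩
  exact ((Relation.EqvGen.rel _ _ ⟨_, L.coneFiberEval_isQuasiIso⟩).symm).trans _ _ _
    ((Relation.EqvGen.rel _ _ ⟨f, hf⟩).trans _ _ _ (Relation.EqvGen.rel _ _ ⟨g, hg⟩).symm)
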